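/- Let $d$ be a positive integer. An object is a nonempty compact convex subset of $\mathbb{R}^d$. A finite set $S$ of objects is $t$-thin (for an integer $t\ge 1$) if every point of $\mathbb{R}^d$ lies in the interior of at most $t$ objects of $S$; its intersection graph $G$ has vertex set $S$, two distinct objects being adjacent if and only if they intersect. A strict linear ordering $\prec$ of $S$ is sizewise if $u\prec v$ implies $\operatorname{diam}(u)\ge\operatorname{diam}(v)$. A vertex $u$ is weakly $k$-reachable from $v$ if $u\preceq v$ and $G$ contains a path from $v$ to $u$ of length at most $k$ all of whose internal vertices $x$ satisfy $u\prec x$; $\mathrm{wcol}_{\prec,k}(G)$ is the maximum over all $v\in V(G)$ of the number of vertices weakly $k$-reachable from $v$ (and $0$ if $S$ is empty). Let $t\ge1$ be an integer, let $S$ be a $t$-thin finite set of objects in $\mathbb{R}^d$ with intersection graph $G$, and let $\prec$ be a sizewise linear ordering of $S$. Then for every integer $k\ge 1$: (a) If $S$ consists of translates of positive scalings of one centrally symmetric compact convex set with nonempty interior (symmetric about some point), then $$\mathrm{wcol}_{\prec,k}(G)\le t\,\max(1,\lceil\log_2 k\rceil)\,(4k-1)^d\binom{k+t5^d+2}{t5^d+2}.$$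 (b) If, for a real number $b\ge1$, $S$ consists of $b$-ball-like objects, i.e. $\operatorname{vol}(v)\ge \operatorname{vol}(B(\operatorname{diam}(v)/2))/b$ for every $v\in S$, where $B(a)$ is a Euclidean ball of radius $a$ in $\mathbb{R}^d$, then $$\mathrm{wcol}_{\prec,k}(G)\le t\,b\,\max(1,\lceil\log_2 k\rceil)\,(4k)^d\binom{k+\lfloor tb6^d\rfloor+2}{\lfloor tb6^d\rfloor+2}.$$ Moreover, there is a positive integer $k_0$ depending only on $d$ such that for every integer $t\ge1$, every $t$-thin finite set $S$ of Euclidean balls of positive radius in $\mathbb{R}^d$ with intersection graph $G$, every sizewise linear ordering $\prec$ of $S$, and every integer $k\ge k_0$, $$\mathrm{wcol}_{\prec,k}(G)\le t\,\max(1,\lceil\log_2 k\rceil)\,(4k-1)^d\binom{k+2t+2}{2t+2}.$$ -/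

import Mathlib

namespace ThinIntersection

/-- The set of vertices weakly `k`-reachable from `v` in `G` with respect to the linear ordering
`prec`: those `u ⪯ v` joined to `v` by a path of length at most `k` all of whose internal
vertices are greater than `u`. -/
def weakReach {V : Type*} (G : SimpleGraph V) (prec : V → V → Prop) (k : ℕ) (v : V) : Set V :=
  {u | (u = v ∨ prec u v) ∧
    ∃ p : G.Walk v u, p.IsPath ∧ p.length ≤ k ∧
      ∀ x ∈ p.support, x ≠ v → x ≠ u → prec u x}

/-- The weak `k`-coloring number of `G` for the given ordering: the maximum over the vertices `v`
of the number of vertices weakly `k`-reachable from `v`. -/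
noncomputable def wcol {V : Type*} [Fintype V] (G : SimpleGraph V) (prec : V → V → Prop)
    (k : ℕ) : ℕ :=
  Finset.univ.sup fun v => (weakReach G prec k v).ncard

/-- The objects: nonempty compact convex subsets of Euclidean `d`-space. -/
abbrev Body (d : ℕ) : Type := ConvexBody (EuclideanSpace ℝ (Fin d))

variable {d : ℕ}

/-- The intersection graph of a finite set of objects: distinct objects are adjacent if and only
if they have a common point. -/
def intersectionGraph (S : Finset (Body d)) : SimpleGraph S where
  Adj u v := u ≠ v ∧ ((u.1 : Set (EuclideanSpace ℝ (Fin d))) ∩ v.1).Nonempty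
  symm := ⟨fun u v h => ⟨h.1.symm, by rw [Set.inter_comm]; exact h.2⟩⟩
  loopless := ⟨fun _ h => h.1 rfl⟩

/-- `S` is `t`-thin: every point of the space lies in the interior of at most `t` objects. -/
def IsThin (t : ℕ) (S : Finset (Body d)) : Prop :=
  ∀ x : EuclideanSpace ℝ (Fin d),
    {u : Body d | u ∈ S ∧ x ∈ interior (u : Set (EuclideanSpace ℝ (Fin d)))}.ncard ≤ t

/-- A sizewise linear ordering: a (strict) linear ordering of `S` by non-increasing diameter. -/
def IsSizewise (S : Finset (Body d)) (prec : S → S → Prop) : Prop :=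
  IsStrictTotalOrder S prec ∧
    ∀ u v : S, prec u v →
      Metric.diam (v.1 : Set (EuclideanSpace ℝ (Fin d))) ≤
        Metric.diam (u.1 : Set (EuclideanSpace ℝ (Fin d)))

/-- `K` is symmetric with respect to some point `c`. -/
def IsCentrallySymmetric (K : Body d) : Prop :=
  ∃ c : EuclideanSpace ℝ (Fin d), ∀ x ∈ K, (2 : ℝ) • c - x ∈ K

/-- `u` is a scaled (by a positive factor) and translated copy of `K`. -/
def IsHomothet (K u : Body d) : Prop :=
  ∃ (a : EuclideanSpace ℝ (Fin d)) (r : ℝ), 0 < r ∧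
    (u : Set (EuclideanSpace ℝ (Fin d))) = (fun x => a + r • x) '' K

/-- `S` consists of scaled and translated copies of one centrally symmetric body with nonempty
interior. -/
def IsHomothetFamily (S : Finset (Body d)) : Prop :=
  ∃ K : Body d, (interior (K : Set (EuclideanSpace ℝ (Fin d)))).Nonempty ∧
    IsCentrallySymmetric K ∧ ∀ u ∈ S, IsHomothet K u

/-- `u` is `b`-ball-like: `vol u ≥ vol (B (diam u / 2)) / b`. -/
def IsBallLike (b : ℝ) (u : Body d) : Prop :=
  (MeasureTheory.volume : MeasureTheory.Measure (EuclideanSpace ℝ (Fin d))).real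
      (Metric.closedBall 0 (Metric.diam (u : Set (EuclideanSpace ℝ (Fin d))) / 2)) / b ≤
    (MeasureTheory.volume : MeasureTheory.Measure (EuclideanSpace ℝ (Fin d))).real
      (u : Set (EuclideanSpace ℝ (Fin d)))

/-- `u` is a Euclidean ball of positive radius. -/
def IsBall (u : Body d) : Prop :=
  ∃ (c : EuclideanSpace ℝ (Fin d)) (r : ℝ), 0 < r ∧
    (u : Set (EuclideanSpace ℝ (Fin d))) = Metric.closedBall c r

end ThinIntersection

/-!
Fix a vertex `v` and measure the objects by a diameter `δ` in a suitable seminorm: the gauge of the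
common shape for homothets, the Euclidean norm otherwise. On a path that witnesses weak
reachability of `u` from `v`, the end `u` has the largest size, so `u` is at distance at most
`(k - 1) * δ u` from `v`. A volume argument (`IsSizing.card_le`) bounds the number of such `u` with
size in a given octave `[D, 2 * D)`, and it remains to bound the number of octaves that contain a
reachable object.

Split the octaves into `L = max 1 ⌈log₂ k⌉` residue classes, so that consecutive octaves of a class
differ by a factor of at least `k`, and give each object a level in the resulting scale `D`. When
the objects of a path reach a new highest level `q` for the first time, all earlier ones have some
level at most `p < q` and hence size less than `D p`, so the new object is at distance less than
`k * D p ≤ D (p + 1)` from `v`. Thus levels are reached by increasing steps `p → q`, and a step from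
`p` remains possible from every level between `p` and `q`. If at most `s` steps lead over each level,
then at most `(k + s).choose s` levels are reached by `k` steps (`encard_chainReach_le`). As
steps are counted by the level they lead to, the next few levels contribute one step each, and the
others are counted by objects that are large compared to their distance from `v`. For arbitrary
ball-like objects their number is bounded by packing again.

For balls this number is close to `2 * t`: huge balls that almost touch a point `c` look like half
spaces, and apart from the rare directions almost orthogonal to the one of its center, such a
ball contains one of two antipodal points close to `c`. Averaging over a grid of directions
(`IsThin.card_mul_pred_le`) gives the bound `2 * t * M / (M - 1)`, where `M` may be taken of order
`√k` for objects that are at least two levels up. If `t` is small compared to `√k`, or if the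
dimension is one, this is a bound by `2 * t`, which proves the claim. Otherwise, a few more
levels are set apart, and the resulting loss of a factor of order at most `k ^ (3 / 2)` is outweighed
by a refined count (`IsReached.card_le_of_two_le`): an octave that is reached only after `f` steps
contains a number of reachable objects of order `(k - f + 1) ^ d` rather than `k ^ d`, and most
octaves are reached late. This is where `k` has to be large in terms of the dimension.
-/

namespace ThinIntersection

open MeasureTheory

variable {d : ℕ}

/-! ### Counting levels reached by increasing steps -/

/-- The levels that can be reached from `p` by at most `k` strictly increasing steps `r → q`
with `A r q`. -/
def chainReach (A : ℕ → ℕ → Prop) (p : ℕ) : ℕ → Set ℕ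
  | 0 => {p}
  | k + 1 => chainReach A p k ∪ {q | ∃ r ∈ chainReach A p k, r < q ∧ A r q}

section Chains

variable {A : ℕ → ℕ → Prop} {p : ℕ}

lemma chainReach_mono : Monotone (chainReach A p) :=
  monotone_nat_of_le_succ fun _ _ hq => Or.inl hq

lemma self_mem_chainReach (k : ℕ) : p ∈ chainReach A p k :=
  chainReach_mono (Nat.zero_le k) rfl

lemma chainReach_eq_singleton (h : ∀ q, p < q → ¬ A p q) (k : ℕ) :
    chainReach A p k = {p} := by
  induction k with
  | zero => rfl
  | succ k ih =>
    rw [chainReach, ih]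
    ext q
    constructor
    · rintro (hq | ⟨r, rfl, hrq, hA⟩)
      · exact hq
      · exact absurd hA (h q hrq)
    · exact fun hq => Or.inl hq

/-- If `Q` is the highest level reachable in one step, then the levels from `Q` on cost one step
less when starting from `Q`. -/
lemma mem_chainReach_of_le (hA : ∀ i j q, i ≤ j → j < q → A i q → A j q) {Q : ℕ} (hpQ : p < Q)
    (hQ : ∀ q, p < q → A p q → q ≤ Q) {k q : ℕ} (hq : q ∈ chainReach A p (k + 1))
    (hQq : Q ≤ q) : q ∈ chainReach A Q k := by
  induction k generalizing q with
  | zero =>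
    rcases hq with hq | ⟨r, hr, hrq, h⟩
    · have : q = p := hq
      omega
    · have : r = p := hr
      subst this
      exact le_antisymm (hQ q hrq h) hQq
  | succ k ih =>
    rcases hq with hq | ⟨r, hr, hrq, h⟩
    · exact chainReach_mono (Nat.le_succ k) (ih hq hQq)
    · rcases le_or_gt Q r with hQr | hQr
      · exact Or.inr ⟨r, ih hr hQr, hrq, h⟩
      · rcases hQq.eq_or_lt with rfl | hlt
        · exact self_mem_chainReach _
        · exact Or.inr ⟨Q, self_mem_chainReach _, hlt, hA r Q q hQr.le hlt h⟩

lemma mem_chainReach_restrict {Q k q : ℕ} (hq : q ∈ chainReach A p k) (hqQ : q < Q) :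
    q ∈ chainReach (fun i j => A i j ∧ j < Q) p k := by
  induction k generalizing q with
  | zero => exact hq
  | succ k ih =>
    rcases hq with hq | ⟨r, hr, hrq, h⟩
    · exact Or.inl (ih hq hqQ)
    · exact Or.inr ⟨r, ih hr (hrq.trans hqQ), hrq, h, hqQ⟩

end Chains

/-- If at most `s` steps lead over any given level, then at most `(k + s).choose s` levels can be
reached by `k` steps. With `Q` the highest level reachable in one step, the levels below `Q` are
reached without the step that leads over all of them, and those from `Q` on are reached from `Q`
by `k - 1` steps: this is Pascal's recursion. -/
lemma encard_chainReach_le (s : ℕ) : ∀ (A : ℕ → ℕ → Prop)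
    (_ : ∀ i j q, i ≤ j → j < q → A i q → A j q) (k p : ℕ)
    (_ : ∀ i, p ≤ i → {q | i < q ∧ A i q}.encard ≤ s),
    (chainReach A p k).encard ≤ ((k + s).choose s : ℕ) := by
  have one_le : ∀ k s : ℕ, (1 : ℕ∞) ≤ ((k + s).choose s : ℕ) := fun k s => by
    exact_mod_cast Nat.choose_pos (Nat.le_add_left s k)
  induction s with
  | zero =>
    intro A hA k p hs
    rw [chainReach_eq_singleton, Set.encard_singleton]
    · exact one_le k 0
    · intro q hq h
      have := hs p le_rfl
      rw [Nat.cast_zero, nonpos_iff_eq_zero, Set.encard_eq_zero] at this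
      exact Set.eq_empty_iff_forall_notMem.1 this q ⟨hq, h⟩
  | succ s ihs =>
    intro A hA k
    induction k with
    | zero =>
      intro p hs
      rw [chainReach, Set.encard_singleton]
      exact one_le 0 (s + 1)
    | succ k ihk =>
      intro p hs
      by_cases hne : {q | p < q ∧ A p q}.Nonempty
      · have hfin : {q | p < q ∧ A p q}.Finite := Set.finite_of_encard_le_coe (hs p le_rfl)
        obtain ⟨Q, ⟨hpQ, hAQ⟩, hQ⟩ := hfin.exists_maximal hne
        have hQ' : ∀ q, p < q → A p q → q ≤ Q := fun q h1 h2 => by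
          by_contra hlt
          exact hlt (hQ ⟨h1, h2⟩ (not_le.1 hlt).le)
        have hsub : chainReach A p (k + 1) ⊆
            chainReach (fun i j => A i j ∧ j < Q) p (k + 1) ∪ chainReach A Q k := fun q hq => by
          rcases lt_or_ge q Q with h | h
          · exact Or.inl (mem_chainReach_restrict hq h)
          · exact Or.inr (mem_chainReach_of_le hA hpQ hQ' hq h)
        have h1 := ihs (fun i j => A i j ∧ j < Q)
          (fun i j q hij hjq h => ⟨hA i j q hij hjq h.1, h.2⟩) (k + 1) p (fun i hi => by
            rcases lt_or_ge i Q with hiQ | hiQ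
            · have hmem : Q ∉ {q | i < q ∧ A i q ∧ q < Q} := fun h => lt_irrefl _ h.2.2
              have hle : (insert Q {q | i < q ∧ A i q ∧ q < Q}).encard ≤ ((s + 1 : ℕ) : ℕ∞) := by
                refine le_trans (Set.encard_le_encard ?_) (hs i hi)
                rintro q (rfl | h)
                · exact ⟨hiQ, hA p i q hi hiQ hAQ⟩
                · exact ⟨h.1, h.2.1⟩
              rw [Set.encard_insert_of_notMem hmem, Nat.cast_add, Nat.cast_one] at hle
              exact (ENat.add_le_add_iff_right (by simp)).1 hle
            · have : {q | i < q ∧ A i q ∧ q < Q} = ∅ := by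
                ext q
                simp only [Set.mem_ofPred_eq, Set.mem_empty_iff_false, iff_false]
                omega
              rw [this, Set.encard_empty]
              exact bot_le)
        have h2 := ihk Q (fun i hi => hs i (hpQ.le.trans hi))
        calc (chainReach A p (k + 1)).encard
            ≤ _ := Set.encard_le_encard hsub
          _ ≤ _ := Set.encard_union_le _ _
          _ ≤ ((k + 1 + s).choose s : ℕ) + ((k + (s + 1)).choose (s + 1) : ℕ) := add_le_add h1 h2
          _ = ((k + 1 + (s + 1)).choose (s + 1) : ℕ) := by
            rw [← Nat.cast_add]
            congr 1
            rw [show k + 1 + (s + 1) = (k + 1 + s) + 1 by ring, Nat.choose_succ_succ,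
              show k + (s + 1) = k + 1 + s by ring]
      · rw [chainReach_eq_singleton, Set.encard_singleton]
        · exact one_le _ _
        · exact fun q h1 h2 => hne ⟨q, h1, h2⟩

lemma sum_range_choose_add (k r : ℕ) :
    ∑ j ∈ Finset.range (k + 1), (j + r).choose r = (k + r + 1).choose (r + 1) := by
  induction k with
  | zero => simp
  | succ k ih =>
    rw [Finset.sum_range_succ, ih, Nat.choose_succ_succ (k + 1 + r) r, add_comm,
      show k + 1 + r = k + r + 1 by ring]

/-- An increasing family of sets of at most `(k + s).choose s` elements, summed with a polynomial
weight of degree `e` in `k` minus the first index at which an element appears. -/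
lemma sum_choose_sub_find_le {F : ℕ → Finset ℕ} (hF : Monotone F) {s : ℕ}
    (hs : ∀ k, (F k).card ≤ (k + s).choose s) (e k : ℕ) :
    ∑ q ∈ F k, (k - sInf {c | q ∈ F c} + e).choose e ≤ (k + s + e).choose (s + e) := by
  induction e generalizing k with
  | zero => simpa using hs k
  | succ e ih =>
    have hmem : ∀ j q, q ∈ F j → q ∈ F (sInf {c | q ∈ F c}) := fun j q hq =>
      Nat.sInf_mem (s := {c | q ∈ F c}) ⟨j, hq⟩
    calc ∑ q ∈ F k, (k - sInf {c | q ∈ F c} + (e + 1)).choose (e + 1)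
        = ∑ q ∈ F k, ∑ j ∈ Finset.range (k + 1),
            if q ∈ F j then (j - sInf {c | q ∈ F c} + e).choose e else 0 := by
          refine Finset.sum_congr rfl fun q hq => ?_
          set m := sInf {c | q ∈ F c} with hm
          have hmk : m ≤ k := Nat.sInf_le hq
          have hiff : ∀ j, q ∈ F j ↔ m ≤ j := fun j =>
            ⟨fun h => Nat.sInf_le h, fun h => hF h (hmem k q hq)⟩
          simp_rw [hiff]
          rw [← Finset.sum_filter]
          rw [show k - m + (e + 1) = k - m + e + 1 by ring, ← sum_range_choose_add]
          refine Finset.sum_nbij' (fun j => j + m) (fun j => j - m) ?_ ?_ ?_ ?_ ?_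
          · intro j hj; simp at hj ⊢; omega
          · intro j hj; simp at hj ⊢; omega
          · intro j hj; simp
          · intro j hj; simp at hj ⊢; omega
          · intro j hj; simp
      _ = ∑ j ∈ Finset.range (k + 1), ∑ q ∈ F j, (j - sInf {c | q ∈ F c} + e).choose e := by
          rw [Finset.sum_comm]
          refine Finset.sum_congr rfl fun j hj => ?_
          rw [← Finset.sum_filter]
          refine Finset.sum_congr ?_ fun _ _ => rfl
          ext q
          simp only [Finset.mem_filter, and_iff_right_iff_imp]
          exact fun h => hF (by simp at hj; omega) h
      _ ≤ ∑ j ∈ Finset.range (k + 1), (j + (s + e)).choose (s + e) :=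
          Finset.sum_le_sum fun j _ => by simpa [add_assoc] using ih j
      _ = _ := by rw [sum_range_choose_add]; simp [add_assoc]

/-! ### Packing in thin families -/

lemma volume_real_homothety (y : EuclideanSpace ℝ (Fin d)) {r : ℝ} (hr : 0 ≤ r)
    (s : Set (EuclideanSpace ℝ (Fin d))) :
    volume.real (AffineMap.homothety y r '' s) = r ^ d * volume.real s := by
  rw [measureReal_def, measureReal_def, Measure.addHaar_image_homothety, ENNReal.toReal_mul,
    ENNReal.toReal_ofReal (abs_nonneg _), abs_of_nonneg (by positivity), finrank_euclideanSpace_fin]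

lemma volume_real_add_smul (a : EuclideanSpace ℝ (Fin d)) {r : ℝ} (hr : 0 ≤ r)
    (s : Set (EuclideanSpace ℝ (Fin d))) :
    volume.real ((fun x => a + r • x) '' s) = r ^ d * volume.real s := by
  have : (fun x => a + r • x) '' s = (fun x => a + x) '' (AffineMap.homothety 0 r '' s) := by
    rw [Set.image_image]
    simp [AffineMap.homothety_apply]
  rw [this, ← volume_real_homothety 0 hr, measureReal_def, measureReal_def, Set.image_add_left,
    measure_preimage_add]

lemma seminorm_closedBall_eq_image (N : Seminorm ℝ (EuclideanSpace ℝ (Fin d)))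
    (c : EuclideanSpace ℝ (Fin d)) {r : ℝ} (hr : 0 < r) :
    N.closedBall c r = (fun x => c + r • x) '' N.closedBall 0 1 := by
  ext x
  simp only [Seminorm.mem_closedBall, Set.mem_image, sub_zero]
  constructor
  · intro hx
    refine ⟨r⁻¹ • (x - c), ?_, ?_⟩
    · rw [map_smul_eq_mul, Real.norm_of_nonneg (by positivity), inv_mul_le_one₀ hr]
      exact hx
    · rw [smul_inv_smul₀ hr.ne']
      abel
  · rintro ⟨y, hy, rfl⟩
    rw [add_sub_cancel_left, map_smul_eq_mul, Real.norm_of_nonneg hr.le]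
    exact mul_le_of_le_one_right hr.le hy

/-- Convex sets inside the objects of a `t`-thin family and inside a set `B` have total volume at
most `t` times that of `B`, as their interiors cover each point of `B` at most `t` times. -/
lemma IsThin.sum_volume_le {t : ℕ} {S : Finset (Body d)} (hS : IsThin t S) {F : Finset (Body d)}
    (hF : F ⊆ S) {C : Body d → Set (EuclideanSpace ℝ (Fin d))}
    {B : Set (EuclideanSpace ℝ (Fin d))} (hB : volume B ≠ ⊤) (hC : ∀ u ∈ F, Convex ℝ (C u))
    (hCu : ∀ u ∈ F, C u ⊆ u) (hCB : ∀ u ∈ F, C u ⊆ B) :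
    ∑ u ∈ F, volume.real (C u) ≤ t * volume.real B := by
  classical
  have hint : ∀ u ∈ F, volume (C u) = volume (interior (C u)) := fun u hu =>
    (measure_congr (interior_ae_eq_of_null_frontier ((hC u hu).addHaar_frontier volume))).symm
  have hfin : ∀ u ∈ F, volume (C u) ≠ ⊤ := fun u hu => measure_ne_top_of_subset (hCB u hu) hB
  have key : ∑ u ∈ F, volume (C u) ≤ t * volume B := by
    calc ∑ u ∈ F, volume (C u)
        = ∑ u ∈ F, ∫⁻ x, (interior (C u)).indicator 1 x := by
          refine Finset.sum_congr rfl fun u hu => ?_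
          rw [lintegral_indicator_one isOpen_interior.measurableSet, hint u hu]
      _ = ∫⁻ x, ∑ u ∈ F, (interior (C u)).indicator 1 x := by
          rw [lintegral_finsetSum]
          exact fun u _ => measurable_one.indicator isOpen_interior.measurableSet
      _ ≤ ∫⁻ x, B.indicator (fun _ : EuclideanSpace ℝ (Fin d) => (t : ENNReal)) x := by
          refine lintegral_mono fun x => ?_
          by_cases hx : x ∈ B
          · have h1 : ∑ u ∈ F, (interior (C u)).indicator (1 : EuclideanSpace ℝ (Fin d) → ENNReal) x =
                ((F.filter fun u => x ∈ interior (C u)).card : ENNReal) := by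
              simp only [Set.indicator_apply, Pi.one_apply]
              rw [Finset.sum_boole]
            rw [h1, Set.indicator_of_mem hx]
            refine Nat.cast_le.2 (le_trans ?_ (hS x))
            rw [← Set.ncard_coe_finset]
            refine Set.ncard_le_ncard ?_ (S.finite_toSet.subset fun u hu => hu.1)
            intro u hu
            have hu' := Finset.mem_filter.1 (Finset.mem_coe.1 hu)
            exact ⟨hF hu'.1, interior_mono (hCu u hu'.1) hu'.2⟩
          · refine le_of_eq_of_le (Finset.sum_eq_zero fun u hu => ?_) bot_le
            exact Set.indicator_of_notMem (fun h => hx (hCB u hu (interior_subset h))) _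
      _ ≤ t * volume B := lintegral_indicator_const_le _ _
  simp only [measureReal_def]
  rw [← ENNReal.toReal_sum hfin, ← ENNReal.toReal_natCast, ← ENNReal.toReal_mul]
  exact ENNReal.toReal_mono (ENNReal.mul_ne_top (ENNReal.natCast_ne_top t) hB) key

/-- The common setting for homothets, ball-like objects and balls: `δ` measures the objects like a
diameter with respect to the seminorm `N`, every object lies in a ball of radius `θ` times its size
around one of its points, and its volume is at least `1 / b` times that of a ball of the same
diameter. An object of size zero is a single point. -/
structure IsSizing (S : Finset (Body d)) (N : Seminorm ℝ (EuclideanSpace ℝ (Fin d))) (b θ : ℝ)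
    (δ : Body d → ℝ) : Prop where
  volume_pos : 0 < volume.real (N.closedBall 0 1)
  one_le : 1 ≤ b
  theta_nonneg : 0 ≤ θ
  theta_le_one : θ ≤ 1
  nonneg : ∀ u, 0 ≤ δ u
  seminorm_sub_le : ∀ u ∈ S, ∀ x ∈ u, ∀ y ∈ u, N (x - y) ≤ δ u
  exists_center : ∀ u ∈ S, ∃ c ∈ u, ∀ x ∈ u, N (x - c) ≤ θ * δ u
  volume_le : ∀ u ∈ S, (δ u / 2) ^ d * volume.real (N.closedBall 0 1) / b ≤
    volume.real (u : Set (EuclideanSpace ℝ (Fin d)))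
  mono : ∀ u ∈ S, ∀ v ∈ S, Metric.diam (v : Set (EuclideanSpace ℝ (Fin d))) ≤
    Metric.diam (u : Set (EuclideanSpace ℝ (Fin d))) → δ v ≤ δ u
  eq_of_zero : ∀ u ∈ S, δ u = 0 → ∀ x ∈ u, ∀ y ∈ u, x = y

/-- The packing bound: each object is shrunk to size `Δ` towards a point it shares with the
ball. -/
lemma IsSizing.card_le {t : ℕ} {S : Finset (Body d)} (hS : IsThin t S)
    {N : Seminorm ℝ (EuclideanSpace ℝ (Fin d))} {b θ : ℝ} {δ : Body d → ℝ}
    (h : IsSizing S N b θ δ) {F : Finset (Body d)} (hF : F ⊆ S) (c : EuclideanSpace ℝ (Fin d))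
    {r Δ : ℝ} (hΔ : 0 < Δ) (hr : 0 ≤ r) (hFΔ : ∀ u ∈ F, Δ ≤ δ u)
    (hFr : ∀ u ∈ F, ∃ y ∈ u, N (y - c) ≤ r) :
    (F.card : ℝ) ≤ t * b * (2 * (r + Δ) / Δ) ^ d := by
  classical
  set V := volume.real (N.closedBall 0 1) with hV
  have hb : 0 < b := one_pos.trans_le h.one_le
  have hVpos : 0 < V := h.volume_pos
  choose! y hyu hyr using hFr
  have hBvol : volume.real (N.closedBall c (r + Δ)) = (r + Δ) ^ d * V := by
    rw [seminorm_closedBall_eq_image N c (by positivity), volume_real_add_smul _ (by positivity)]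
  have hBfin : volume (N.closedBall c (r + Δ)) ≠ ⊤ := by
    intro htop
    rw [measureReal_def, htop, ENNReal.toReal_top] at hBvol
    have : 0 < (r + Δ) ^ d * V := by positivity
    exact this.ne hBvol
  have hpt : ∀ u ∈ F, ∀ x, AffineMap.homothety (y u) (Δ / δ u) x =
      y u + (Δ / δ u) • (x - y u) := fun u _ x => by
    rw [AffineMap.homothety_apply, vsub_eq_sub, vadd_eq_add, add_comm]
  have hδ : ∀ u ∈ F, 0 < δ u := fun u hu => hΔ.trans_le (hFΔ u hu)
  have hsum := hS.sum_volume_le hF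
    (C := fun u => AffineMap.homothety (y u) (Δ / δ u) '' (u : Set (EuclideanSpace ℝ (Fin d))))
    hBfin (fun u hu => u.convex.affine_image _)
    (fun u hu => by
      rintro _ ⟨x, hx, rfl⟩
      rw [hpt u hu]
      exact u.convex.add_smul_sub_mem (hyu u hu) hx
        ⟨by have := hδ u hu; positivity, (div_le_one (hδ u hu)).2 (hFΔ u hu)⟩)
    (fun u hu => by
      rintro _ ⟨x, hx, rfl⟩
      rw [hpt u hu, Seminorm.mem_closedBall]
      have hpos := hδ u hu
      calc N (y u + (Δ / δ u) • (x - y u) - c)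
          = N ((y u - c) + (Δ / δ u) • (x - y u)) := by congr 1; abel
        _ ≤ N (y u - c) + N ((Δ / δ u) • (x - y u)) := map_add_le_add N _ _
        _ ≤ r + Δ / δ u * δ u := by
            refine add_le_add (hyr u hu) ?_
            rw [map_smul_eq_mul, Real.norm_of_nonneg (by positivity)]
            exact mul_le_mul_of_nonneg_left (h.seminorm_sub_le u (hF hu) x hx _ (hyu u hu))
              (by positivity)
        _ = r + Δ := by rw [div_mul_cancel₀ _ hpos.ne'])
  have hlow : ∀ u ∈ F, (Δ / 2) ^ d * V / b ≤ volume.real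
      (AffineMap.homothety (y u) (Δ / δ u) '' (u : Set (EuclideanSpace ℝ (Fin d)))) := by
    intro u hu
    have hpos := hδ u hu
    rw [volume_real_homothety _ (by positivity)]
    calc (Δ / 2) ^ d * V / b = (Δ / δ u) ^ d * ((δ u / 2) ^ d * V / b) := by
          rw [mul_div_assoc', ← mul_assoc, ← mul_pow]
          congr 3
          field_simp
      _ ≤ _ := mul_le_mul_of_nonneg_left (h.volume_le u (hF hu)) (by positivity)
  have hcard := (Finset.card_nsmul_le_sum F _ _ hlow).trans hsum
  rw [nsmul_eq_mul, hBvol] at hcard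
  have hm : 0 < (Δ / 2) ^ d * V / b := by positivity
  refine le_of_mul_le_mul_right (hcard.trans_eq ?_) hm
  rw [show 2 * (r + Δ) / Δ = (r + Δ) / (Δ / 2) by field_simp, div_pow]
  field_simp

/-! ### Large balls close to a point -/

/-- A ball of radius `R` at distance at most `r` from the origin, with `R` much larger than `r`,
contains one of the points `± (6 * r / η) • e` in its interior unless `e` is almost orthogonal to
the direction of its center. -/
lemma norm_sub_smul_lt_or {z e : EuclideanSpace ℝ (Fin d)} {R r B η : ℝ} (hr : 0 < r) (hη : 0 < η)
    (hz : ‖z‖ ≤ R + r) (he : ‖e‖ ^ 2 ≤ B) (hR : 12 * r ≤ R) (hRB : 12 * r * B < R * η ^ 2)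
    (hze : η * ‖z‖ ≤ |inner ℝ z e|) :
    ‖z - (6 * r / η) • e‖ < R ∨ ‖z + (6 * r / η) • e‖ < R := by
  set σ := 6 * r / η with hσ
  have hσpos : 0 < σ := by positivity
  have hση : σ * η = 6 * r := by rw [hσ]; field_simp
  have hRpos : 0 < R := by linarith
  have hσB : σ ^ 2 * ‖e‖ ^ 2 < 3 * r * R := by
    have h1 : σ ^ 2 * ‖e‖ ^ 2 ≤ σ ^ 2 * B := by gcongr
    have h2 : (σ ^ 2 * B) * η ^ 2 < (3 * r * R) * η ^ 2 := by
      have : (σ ^ 2 * B) * η ^ 2 = 3 * r * (12 * r * B) := by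
        rw [show (σ ^ 2 * B) * η ^ 2 = (σ * η) ^ 2 * B by ring, hση]; ring
      rw [this]
      nlinarith
    exact h1.trans_lt (lt_of_mul_lt_mul_right h2 (by positivity))
  have hz2 : ‖z‖ ^ 2 - R ^ 2 ≤ 3 * r * R := by
    have := norm_nonneg z
    nlinarith
  have hsub : ‖z - σ • e‖ ^ 2 = ‖z‖ ^ 2 - 2 * (σ * inner ℝ z e) + σ ^ 2 * ‖e‖ ^ 2 := by
    rw [norm_sub_sq_real, inner_smul_right, norm_smul, Real.norm_of_nonneg hσpos.le, mul_pow]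
  have hadd : ‖z + σ • e‖ ^ 2 = ‖z‖ ^ 2 + 2 * (σ * inner ℝ z e) + σ ^ 2 * ‖e‖ ^ 2 := by
    rw [norm_add_sq_real, inner_smul_right, norm_smul, Real.norm_of_nonneg hσpos.le, mul_pow]
  suffices h : ‖z‖ ^ 2 - 2 * (σ * |inner ℝ z e|) + σ ^ 2 * ‖e‖ ^ 2 < R ^ 2 by
    rcases abs_cases (inner ℝ z e) with ⟨habs, -⟩ | ⟨habs, -⟩
    · left
      refine lt_of_pow_lt_pow_left₀ 2 hRpos.le ?_
      rw [hsub, ← habs]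
      exact h
    · right
      refine lt_of_pow_lt_pow_left₀ 2 hRpos.le ?_
      rw [hadd]
      rw [habs] at h
      linarith
  rcases le_or_gt (R / 2) ‖z‖ with hzR | hzR
  · have h1 : 3 * r * R ≤ σ * |inner ℝ z e| := by
      calc 3 * r * R = σ * η * (R / 2) := by rw [hση]; ring
        _ ≤ σ * η * ‖z‖ := by gcongr
        _ = σ * (η * ‖z‖) := by ring
        _ ≤ _ := by gcongr
    linarith
  · have h1 : 0 ≤ σ * |inner ℝ z e| := by positivity
    have h2 : ‖z‖ ^ 2 ≤ (R / 2) ^ 2 := by gcongr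
    nlinarith

/-- Large balls of a `t`-thin family that come close to a point `c`. For each direction `e`, at
most `2 * t` of them contain one of two fixed points on the line through `c` in direction `e`, and
each ball is missed for at most `β` of the directions. -/
lemma IsThin.card_mul_card_le {t : ℕ} {S : Finset (Body d)} (hS : IsThin t S)
    {F : Finset (Body d)} (hF : F ⊆ S) {z : Body d → EuclideanSpace ℝ (Fin d)} {R : Body d → ℝ}
    (hball : ∀ u ∈ F, (u : Set (EuclideanSpace ℝ (Fin d))) = Metric.closedBall (z u) (R u))
    {c : EuclideanSpace ℝ (Fin d)} {r : ℝ} (hr : 0 < r) (hz : ∀ u ∈ F, ‖z u - c‖ ≤ R u + r)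
    {ι : Type*} (I : Finset ι) (e : ι → EuclideanSpace ℝ (Fin d)) {B η : ℝ} {β : ℕ} (hη : 0 < η)
    (he : ∀ i ∈ I, ‖e i‖ ^ 2 ≤ B)
    (hβ : ∀ w : EuclideanSpace ℝ (Fin d), (I.filter fun i => |inner ℝ w (e i)| < η * ‖w‖).card ≤ β)
    (hR : ∀ u ∈ F, 12 * r ≤ R u) (hRB : ∀ u ∈ F, 12 * r * B < R u * η ^ 2) :
    F.card * I.card ≤ 2 * t * I.card + F.card * β := by
  classical
  set σ := 6 * r / η with hσ
  have hthin : ∀ x, (F.filter fun u : Body d =>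
      x ∈ interior (u : Set (EuclideanSpace ℝ (Fin d)))).card ≤
      t := fun x => by
    refine le_trans ?_ (hS x)
    rw [← Set.ncard_coe_finset]
    refine Set.ncard_le_ncard ?_ (S.finite_toSet.subset fun u hu => hu.1)
    intro u hu
    have hu' := Finset.mem_filter.1 (Finset.mem_coe.1 hu)
    exact ⟨hF hu'.1, hu'.2⟩
  let hit : Body d → ι → Prop := fun u i =>
    c + σ • e i ∈ interior (u : Set (EuclideanSpace ℝ (Fin d))) ∨
      c - σ • e i ∈ interior (u : Set (EuclideanSpace ℝ (Fin d)))
  have hmiss : ∀ u ∈ F, ∀ i ∈ I, ¬ hit u i → |inner ℝ (z u - c) (e i)| < η * ‖z u - c‖ := by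
    intro u hu i hi hnot
    by_contra! hle
    refine hnot ?_
    have hsub : Metric.ball (z u) (R u) ⊆ interior (u : Set (EuclideanSpace ℝ (Fin d))) := by
      rw [hball u hu]
      exact Metric.ball_subset_interior_closedBall
    rcases norm_sub_smul_lt_or hr hη (hz u hu) (he i hi) (hR u hu) (hRB u hu) hle with h | h
    · left
      apply hsub
      rw [Metric.mem_ball, dist_comm, dist_eq_norm, ← sub_sub]
      exact h
    · right
      apply hsub
      rw [Metric.mem_ball, dist_comm, dist_eq_norm, sub_sub_eq_add_sub, add_sub_right_comm]
      exact h
  have h1 : ∀ u ∈ F, I.card ≤ (I.filter fun i => hit u i).card + β := by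
    intro u hu
    rw [← Finset.card_filter_add_card_filter_not (s := I) (fun i => hit u i)]
    refine Nat.add_le_add_left (le_trans (Finset.card_le_card ?_) (hβ (z u - c))) _
    intro i hi
    rw [Finset.mem_filter] at hi ⊢
    exact ⟨hi.1, hmiss u hu i hi.1 hi.2⟩
  have h2 : ∀ i ∈ I, (F.filter fun u => hit u i).card ≤ 2 * t := by
    intro i _
    rw [Finset.filter_or, two_mul]
    exact (Finset.card_union_le _ _).trans (Nat.add_le_add (hthin _) (hthin _))
  calc F.card * I.card = ∑ u ∈ F, I.card := by simp
    _ ≤ ∑ u ∈ F, ((I.filter fun i => hit u i).card + β) := Finset.sum_le_sum h1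
    _ = ∑ i ∈ I, (F.filter fun u => hit u i).card + F.card * β := by
        rw [Finset.sum_add_distrib, Finset.sum_const, smul_eq_mul]
        congr 1
        exact Finset.sum_card_bipartiteAbove_eq_sum_card_bipartiteBelow hit
    _ ≤ ∑ _i ∈ I, 2 * t + F.card * β := Nat.add_le_add_right (Finset.sum_le_sum h2) _
    _ = _ := by simp [mul_comm]

/-- The grid vector with the given natural coordinates. -/
noncomputable def gridVector (f : Fin d → ℕ) : EuclideanSpace ℝ (Fin d) :=
  WithLp.toLp 2 fun i => (f i : ℝ)

lemma norm_gridVector_sq_le {M : ℕ} {f : Fin d → ℕ}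
    (hf : f ∈ Fintype.piFinset fun _ : Fin d => Finset.Icc 1 M) :
    ‖gridVector f‖ ^ 2 ≤ d * M ^ 2 := by
  rw [EuclideanSpace.real_norm_sq_eq]
  calc ∑ i, (gridVector f).ofLp i ^ 2 ≤ ∑ _i : Fin d, (M : ℝ) ^ 2 := by
        refine Finset.sum_le_sum fun i _ => ?_
        have h1 := (Finset.mem_Icc.1 (Fintype.mem_piFinset.1 hf i)).2
        have h2 : (f i : ℝ) ≤ M := by exact_mod_cast h1
        simp only [gridVector]
        gcongr
    _ = d * M ^ 2 := by simp

lemma exists_norm_le_sqrt_mul (hd : 1 ≤ d) (w : EuclideanSpace ℝ (Fin d)) :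
    ∃ i, ‖w‖ ≤ √d * |w i| := by
  have : Nonempty (Fin d) := ⟨⟨0, hd⟩⟩
  obtain ⟨i, hi⟩ := Finite.exists_max fun i => |w i|
  refine ⟨i, ?_⟩
  rw [← Real.sqrt_sq_eq_abs, ← Real.sqrt_mul (Nat.cast_nonneg d), EuclideanSpace.norm_eq]
  refine Real.sqrt_le_sqrt ?_
  calc ∑ j, ‖w j‖ ^ 2 ≤ ∑ _j : Fin d, w i ^ 2 := by
        refine Finset.sum_le_sum fun j _ => ?_
        rw [Real.norm_eq_abs, ← sq_abs (w i)]
        have := hi j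
        gcongr
    _ = d * w i ^ 2 := by simp

/-- Few grid vectors are almost orthogonal to `w`: fixing all coordinates but one in which `w` is
large leaves at most one choice for the remaining coordinate. -/
lemma card_filter_inner_gridVector_le (hd : 1 ≤ d) (M : ℕ) (w : EuclideanSpace ℝ (Fin d)) :
    ((Fintype.piFinset fun _ : Fin d => Finset.Icc 1 M).filter fun f =>
      |inner ℝ w (gridVector f)| < 1 / (2 * √d) * ‖w‖).card ≤ M ^ (d - 1) := by
  classical
  obtain ⟨i, hi⟩ := exists_norm_le_sqrt_mul hd w
  have hsd : 0 < √(d : ℝ) := Real.sqrt_pos.2 (by exact_mod_cast hd)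
  have hinner : ∀ f : Fin d → ℕ, inner ℝ w (gridVector f) = ∑ j, w j * f j := fun f => by
    simp [PiLp.inner_apply, gridVector, mul_comm]
  have hcard : (Fintype.piFinset fun j : Fin d =>
      if j = i then ({1} : Finset ℕ) else Finset.Icc 1 M).card = M ^ (d - 1) := by
    rw [Fintype.card_piFinset, ← Finset.mul_prod_erase _ _ (Finset.mem_univ i)]
    rw [Finset.prod_congr rfl (g := fun _ => M)]
    · simp
    · intro j hj
      simp [Finset.ne_of_mem_erase hj]
  rw [← hcard]
  refine Finset.card_le_card_of_injOn (fun f => Function.update f i 1) ?_ ?_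
  · intro f hf
    have hf' := Fintype.mem_piFinset.1 (Finset.mem_filter.1 (Finset.mem_coe.1 hf)).1
    rw [Finset.mem_coe, Fintype.mem_piFinset]
    intro j
    by_cases hj : j = i
    · subst hj; simp
    · simpa [hj] using hf' j
  · intro f hf g hg hfg
    have hf' := (Finset.mem_filter.1 (Finset.mem_coe.1 hf)).2
    have hg' := (Finset.mem_filter.1 (Finset.mem_coe.1 hg)).2
    have hne : ∀ j, j ≠ i → f j = g j := fun j hj => by
      have := congrFun hfg j
      simpa [hj] using this
    have hdiff : inner ℝ w (gridVector f) - inner ℝ w (gridVector g) =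
        w i * ((f i : ℝ) - g i) := by
      rw [hinner, hinner, ← Finset.sum_sub_distrib, Finset.sum_eq_single i]
      · ring
      · intro j _ hj
        rw [hne j hj]; ring
      · simp
    have hlt : |w i| * |(f i : ℝ) - g i| < |w i| := by
      rw [← abs_mul, ← hdiff]
      calc _ ≤ |inner ℝ w (gridVector f)| + |inner ℝ w (gridVector g)| := abs_sub _ _
        _ < 1 / (2 * √d) * ‖w‖ + 1 / (2 * √d) * ‖w‖ := add_lt_add hf' hg'
        _ = ‖w‖ / √d := by field_simp; ring
        _ ≤ |w i| := by rw [div_le_iff₀ hsd]; linarith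
    have hfi : f i = g i := by
      by_contra hcon
      have h1 : (1 : ℝ) ≤ |(f i : ℝ) - g i| := by
        have : (1 : ℤ) ≤ |(f i : ℤ) - g i| := Int.one_le_abs (by omega)
        exact_mod_cast this
      have := abs_nonneg (w i)
      nlinarith
    funext j
    by_cases hj : j = i
    · subst hj; exact hfi
    · exact hne j hj

/-- Averaging over the grid `{1, …, M} ^ d`, of which at most a fraction of `1 / M` misses any given
ball. -/
lemma IsThin.card_mul_pred_le (hd : 1 ≤ d) {t : ℕ} {S : Finset (Body d)} (hS : IsThin t S)
    {F : Finset (Body d)} (hF : F ⊆ S) {z : Body d → EuclideanSpace ℝ (Fin d)} {R : Body d → ℝ}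
    (hball : ∀ u ∈ F, (u : Set (EuclideanSpace ℝ (Fin d))) = Metric.closedBall (z u) (R u))
    {c : EuclideanSpace ℝ (Fin d)} {r : ℝ} (hr : 0 < r) (hz : ∀ u ∈ F, ‖z u - c‖ ≤ R u + r)
    {M : ℕ} (hM : 1 ≤ M) (hR : ∀ u ∈ F, 48 * d ^ 2 * M ^ 2 * r < R u) :
    F.card * (M - 1) ≤ 2 * t * M := by
  have hd' : (1 : ℝ) ≤ d := by exact_mod_cast hd
  have hM' : (1 : ℝ) ≤ M := by exact_mod_cast hM
  have hdM : (1 : ℝ) ≤ d ^ 2 * M ^ 2 := one_le_mul_of_one_le_of_one_le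
    (one_le_pow₀ hd') (one_le_pow₀ hM')
  have key := hS.card_mul_card_le hF hball hr hz
    (Fintype.piFinset fun _ : Fin d => Finset.Icc 1 M) gridVector (η := 1 / (2 * √d))
    (by positivity) (fun f hf => norm_gridVector_sq_le hf)
    (card_filter_inner_gridVector_le hd M)
    (fun u hu => by nlinarith [hR u hu])
    (fun u hu => by
      rw [div_pow, mul_pow, Real.sq_sqrt (by positivity), one_pow, mul_one_div,
        lt_div_iff₀ (by positivity)]
      nlinarith [hR u hu])
  have hcard : (Fintype.piFinset fun _ : Fin d => Finset.Icc 1 M).card = M * M ^ (d - 1) := by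
    simp [Fintype.card_piFinset, mul_pow_sub_one (by omega : d ≠ 0)]
  rw [hcard] at key
  have hpos : 0 < M ^ (d - 1) := by positivity
  refine Nat.le_of_mul_le_mul_right ?_ hpos
  rw [Nat.mul_sub_one, Nat.sub_mul]
  refine Nat.sub_le_of_le_add ?_
  calc F.card * M * M ^ (d - 1) = F.card * (M * M ^ (d - 1)) := by ring
    _ ≤ _ := key
    _ = _ := by ring

/-- In dimension one the two sides of a point are the only directions. -/
lemma IsThin.card_le_of_dim_one {t : ℕ} {S : Finset (Body 1)} (hS : IsThin t S)
    {F : Finset (Body 1)} (hF : F ⊆ S) {z : Body 1 → EuclideanSpace ℝ (Fin 1)} {R : Body 1 → ℝ}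
    (hball : ∀ u ∈ F, (u : Set (EuclideanSpace ℝ (Fin 1))) = Metric.closedBall (z u) (R u))
    {c : EuclideanSpace ℝ (Fin 1)} {r : ℝ} (hr : 0 < r) (hz : ∀ u ∈ F, ‖z u - c‖ ≤ R u + r)
    (hR : ∀ u ∈ F, 12 * r < R u) : F.card ≤ 2 * t := by
  have key := hS.card_mul_card_le hF hball hr hz {()}
    (fun _ => WithLp.toLp 2 fun _ => (1 : ℝ)) (B := 1) (η := 1) (β := 0) one_pos
    (fun i _ => by simp [EuclideanSpace.real_norm_sq_eq])
    (fun w => by simp [PiLp.inner_apply, EuclideanSpace.norm_eq, Real.sqrt_sq_eq_abs])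
    (fun u hu => (hR u hu).le) (fun u hu => by simpa using hR u hu)
  simpa using key

/-! ### Levels along walks -/

/-- A sequence of lengths that grows at least by the factors `k` and `2` in each step. -/
structure IsScale (k : ℕ) (D : ℕ → ℝ) : Prop where
  pos : ∀ j, 0 < D j
  mul_le : ∀ j, k * D j ≤ D (j + 1)
  two_mul_le : ∀ j, 2 * D j ≤ D (j + 1)

lemma IsScale.monotone {k : ℕ} {D : ℕ → ℝ} (hD : IsScale k D) : Monotone D :=
  monotone_nat_of_le_succ fun j => by linarith [hD.pos j, hD.two_mul_le j]

lemma IsScale.exists_lt {k : ℕ} {D : ℕ → ℝ} (hD : IsScale k D) (x : ℝ) : ∃ n, x < D n := by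
  have hpow : ∀ n, 2 ^ n * D 0 ≤ D n := fun n => by
    induction n with
    | zero => simp
    | succ n ih => rw [pow_succ]; linarith [hD.two_mul_le n]
  obtain ⟨n, hn⟩ := pow_unbounded_of_one_lt (x / D 0) one_lt_two
  exact ⟨n, ((div_lt_iff₀ (hD.pos 0)).1 hn).trans_le (hpow n)⟩

/-- The first member of the sequence `D` that exceeds `x`. -/
noncomputable def level (D : ℕ → ℝ) (x : ℝ) : ℕ := sInf {n | x < D n}

lemma IsScale.lt_level {k : ℕ} {D : ℕ → ℝ} (hD : IsScale k D) (x : ℝ) : x < D (level D x) :=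
  Nat.sInf_mem (s := {n | x < D n}) (hD.exists_lt x)

lemma le_of_lt_level {D : ℕ → ℝ} {x : ℝ} {i : ℕ} (h : i < level D x) : D i ≤ x :=
  not_lt.1 (Nat.notMem_of_lt_sInf (s := {n | x < D n}) h)

lemma level_le {D : ℕ → ℝ} {x : ℝ} {i : ℕ} (h : x < D i) : level D x ≤ i :=
  Nat.sInf_le (s := {n | x < D n}) h

lemma IsScale.level_mono {k : ℕ} {D : ℕ → ℝ} (hD : IsScale k D) : Monotone (level D) :=
  fun _ y hxy => level_le (hxy.trans_lt (hD.lt_level y))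

lemma IsScale.level_eq {k : ℕ} {D : ℕ → ℝ} (hD : IsScale k D) {x : ℝ} {j : ℕ} (h1 : D j ≤ x)
    (h2 : x < D (j + 1)) : level D x = j + 1 := by
  refine le_antisymm (level_le h2) (Nat.succ_le_of_lt ?_)
  by_contra! h
  exact absurd (h1.trans_lt (hD.lt_level x)) (not_lt.2 (hD.monotone h))

/-- The geometric sequence of ratio `2 ^ L` that starts at `D₀ * 2 ^ a`. For `a < L` these
sequences partition the powers of two. -/
noncomputable def dyadicScale (D₀ : ℝ) (L a : ℕ) (j : ℕ) : ℝ := D₀ * 2 ^ (a + j * L)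

lemma isScale_dyadicScale {D₀ : ℝ} (hD₀ : 0 < D₀) {L k : ℕ} (hL : 1 ≤ L) (hk : k ≤ 2 ^ L)
    (a : ℕ) : IsScale k (dyadicScale D₀ L a) := by
  have hpos : ∀ j, 0 < dyadicScale D₀ L a j := fun j => by unfold dyadicScale; positivity
  have hsucc : ∀ j, dyadicScale D₀ L a (j + 1) = 2 ^ L * dyadicScale D₀ L a j := fun j => by
    unfold dyadicScale; ring
  refine ⟨hpos, fun j => ?_, fun j => ?_⟩
  · rw [hsucc]
    exact mul_le_mul_of_nonneg_right (by exact_mod_cast hk) (hpos j).le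
  · rw [hsucc]
    exact mul_le_mul_of_nonneg_right (le_self_pow₀ one_le_two (by omega)) (hpos j).le

lemma le_dyadicScale {D₀ : ℝ} (hD₀ : 0 ≤ D₀) (L a j : ℕ) : D₀ ≤ dyadicScale D₀ L a j :=
  le_mul_of_one_le_right hD₀ (one_le_pow₀ one_le_two)

lemma exists_dyadicScale {D₀ x : ℝ} (hD₀ : 0 < D₀) (hx : D₀ ≤ x) {L : ℕ} (hL : 1 ≤ L) :
    ∃ a < L, ∃ j, dyadicScale D₀ L a j ≤ x ∧ x < 2 * dyadicScale D₀ L a j := by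
  obtain ⟨n, hn1, hn2⟩ := exists_nat_pow_near ((one_le_div hD₀).2 hx) (one_lt_two (α := ℝ))
  refine ⟨n % L, Nat.mod_lt _ hL, n / L, ?_⟩
  have : n % L + n / L * L = n := by rw [mul_comm]; exact Nat.mod_add_div n L
  unfold dyadicScale
  rw [this]
  rw [le_div_iff₀ hD₀] at hn1
  rw [div_lt_iff₀ hD₀, pow_succ] at hn2
  constructor <;> linarith

/-- `W` consists of objects that are reached from `v` by walks of length at most `k` in the
intersection graph of `S` on which they have the largest size. -/
structure IsReached (S : Finset (Body d)) (δ : Body d → ℝ) (k : ℕ) (v : Body d)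
    (W : Finset (Body d)) : Prop where
  subset : W ⊆ S
  eq_of_zero : ∀ u ∈ W, δ u = 0 → u = v
  exists_walk : ∀ u ∈ W, ∃ (x : ℕ → Body d) (n : ℕ), n ≤ k ∧ x 0 = v ∧ x n = u ∧
    (∀ i, x i ∈ S) ∧
    (∀ i < n, ((x i : Set (EuclideanSpace ℝ (Fin d))) ∩ x (i + 1)).Nonempty) ∧
    ∀ i ≤ n, δ (x i) ≤ δ u

section Walks

variable {S : Finset (Body d)} {N : Seminorm ℝ (EuclideanSpace ℝ (Fin d))} {b θ : ℝ}
  {δ : Body d → ℝ}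

lemma IsSizing.exists_seminorm_sub_le (h : IsSizing S N b θ δ) {x : ℕ → Body d}
    {c : EuclideanSpace ℝ (Fin d)} (hc : c ∈ x 0) (hcx : ∀ y ∈ x 0, N (y - c) ≤ θ * δ (x 0))
    (hxS : ∀ i, x i ∈ S) (n : ℕ)
    (hx : ∀ i < n, ((x i : Set (EuclideanSpace ℝ (Fin d))) ∩ x (i + 1)).Nonempty) :
    ∃ y ∈ x n, N (y - c) ≤ θ * δ (x 0) + ∑ i ∈ Finset.Ico 1 n, δ (x i) := by
  induction n with
  | zero => exact ⟨c, hc, by simpa using mul_nonneg h.theta_nonneg (h.nonneg _)⟩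
  | succ n ih =>
    obtain ⟨y, hy, hyc⟩ := ih fun i hi => hx i (hi.trans (Nat.lt_succ_self n))
    obtain ⟨z, hz, hz'⟩ := hx n (Nat.lt_succ_self n)
    refine ⟨z, hz', ?_⟩
    rcases Nat.eq_zero_or_pos n with rfl | hn
    · simpa using hcx z hz
    · rw [Finset.sum_Ico_succ_top hn]
      calc N (z - c) = N ((z - y) + (y - c)) := by rw [sub_add_sub_cancel]
        _ ≤ N (z - y) + N (y - c) := map_add_le_add N _ _
        _ ≤ δ (x n) + _ := add_le_add (h.seminorm_sub_le _ (hxS n) z hz y hy) hyc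
        _ = _ := by ring

/-- A step from level `p` to level `q`: some object of level `q` comes as close to `c` as can be
ensured by a walk all of whose previous objects have size below `D p`. -/
def LevelStep (S : Finset (Body d)) (N : Seminorm ℝ (EuclideanSpace ℝ (Fin d)))
    (δ : Body d → ℝ) (D : ℕ → ℝ) (c : EuclideanSpace ℝ (Fin d)) (ρ : ℝ) (p q : ℕ) : Prop :=
  ∃ w ∈ S, level D (δ w) = q ∧ ∃ y ∈ w, N (y - c) ≤ ρ * D p

lemma LevelStep.mono {k : ℕ} {D : ℕ → ℝ} (hD : IsScale k D) {c : EuclideanSpace ℝ (Fin d)} {ρ : ℝ}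
    (hρ : 0 ≤ ρ) (i j q : ℕ) (hij : i ≤ j) (_ : j < q) (h : LevelStep S N δ D c ρ i q) :
    LevelStep S N δ D c ρ j q := by
  obtain ⟨w, hw, hwq, y, hy, hyc⟩ := h
  exact ⟨w, hw, hwq, y, hy, hyc.trans (mul_le_mul_of_nonneg_left (hD.monotone hij) hρ)⟩

/-- The highest level on a walk is reached by as many level steps as the walk has edges. -/
lemma IsSizing.sup_level_mem_chainReach (h : IsSizing S N b θ δ) {k : ℕ} {D : ℕ → ℝ}
    (hD : IsScale k D) {x : ℕ → Body d} {c : EuclideanSpace ℝ (Fin d)} (hc : c ∈ x 0)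
    (hcx : ∀ y ∈ x 0, N (y - c) ≤ θ * δ (x 0)) (hxS : ∀ i, x i ∈ S) (n : ℕ) (hn : n ≤ k)
    (hx : ∀ i < n, ((x i : Set (EuclideanSpace ℝ (Fin d))) ∩ x (i + 1)).Nonempty) :
    (Finset.range (n + 1)).sup (fun i => level D (δ (x i))) ∈
      chainReach (LevelStep S N δ D c (k - 1 + θ)) (level D (δ (x 0))) n := by
  induction n with
  | zero => simp [chainReach]
  | succ n ih =>
    have ih := ih (Nat.le_of_succ_le hn) fun i hi => hx i (hi.trans (Nat.lt_succ_self n))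
    rw [Finset.range_add_one, Finset.sup_insert]
    set Q := (Finset.range (n + 1)).sup (fun i => level D (δ (x i))) with hQ
    rcases le_or_gt (level D (δ (x (n + 1)))) Q with hle | hlt
    · rw [sup_eq_right.2 hle]
      exact Or.inl ih
    · rw [sup_eq_left.2 hlt.le]
      refine Or.inr ⟨Q, ih, hlt, x (n + 1), hxS _, rfl, ?_⟩
      obtain ⟨y, hy, hyc⟩ := h.exists_seminorm_sub_le hc hcx hxS (n + 1) hx
      refine ⟨y, hy, hyc.trans ?_⟩
      have hlev : ∀ i ∈ Finset.range (n + 1), δ (x i) ≤ D Q := fun i hi =>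
        ((hD.lt_level _).le).trans (hD.monotone (Finset.le_sup (f := fun i => level D (δ (x i))) hi))
      have hsum : ∑ i ∈ Finset.Ico 1 (n + 1), δ (x i) ≤ n * D Q := by
        refine (Finset.sum_le_card_nsmul _ _ (D Q) fun i hi => hlev i ?_).trans_eq (by simp)
        exact Finset.mem_range.2 (Finset.mem_Ico.1 hi).2
      have h0 := mul_le_mul_of_nonneg_left (hlev 0 (by simp)) h.theta_nonneg
      have hnk : (n : ℝ) ≤ k - 1 := by
        rw [le_sub_iff_add_le]
        exact_mod_cast hn
      have := mul_le_mul_of_nonneg_right hnk (hD.pos Q).le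
      linarith

/-- At most one step leads to each of the next `e` levels; steps to higher levels are counted by
their objects, which are large compared to their distance from `c`. -/
lemma encard_levelStep_le {D : ℕ → ℝ} {c : EuclideanSpace ℝ (Fin d)}
    {ρ : ℝ} {e m : ℕ} (i : ℕ) (hm : ∀ F ⊆ S, (∀ u ∈ F, D (i + e) ≤ δ u) →
      (∀ u ∈ F, ∃ y ∈ u, N (y - c) ≤ ρ * D i) → F.card ≤ m) :
    {q | i < q ∧ LevelStep S N δ D c ρ i q}.encard ≤ (e + m : ℕ) := by
  classical
  set F := S.filter fun u => D (i + e) ≤ δ u ∧ ∃ y ∈ u, N (y - c) ≤ ρ * D i with hF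
  have hcard : F.card ≤ m := hm F (Finset.filter_subset _ _)
    (fun u hu => (Finset.mem_filter.1 hu).2.1) fun u hu => (Finset.mem_filter.1 hu).2.2
  have hsub : {q | i < q ∧ LevelStep S N δ D c ρ i q} ⊆
      ((Finset.Ioc i (i + e) ∪ F.image fun u => level D (δ u) : Finset ℕ) : Set ℕ) := by
    rintro q ⟨hiq, w, hw, hwq, hwc⟩
    rw [Finset.mem_coe, Finset.mem_union]
    rcases le_or_gt q (i + e) with hq | hq
    · exact Or.inl (Finset.mem_Ioc.2 ⟨hiq, hq⟩)
    · refine Or.inr (Finset.mem_image.2 ⟨w, Finset.mem_filter.2 ⟨hw, ?_, hwc⟩, hwq⟩)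
      exact le_of_lt_level (hq.trans_eq hwq.symm)
  refine (Set.encard_le_encard hsub).trans ?_
  rw [Set.encard_coe_eq_coe_finsetCard, Nat.cast_le]
  refine (Finset.card_union_le _ _).trans (Nat.add_le_add ?_ (Finset.card_image_le.trans hcard))
  simp

/-- The size of `u` lies in the octave `[D j, 2 * D j)` with `q = j + 1`, so that `u` has level `q`.
At `q = 0` exactly `v` is admitted, which accounts for `v` when it is a single point of size zero. -/
def InOctave (δ : Body d → ℝ) (D : ℕ → ℝ) (v : Body d) (q : ℕ) (u : Body d) : Prop :=
  (u = v ∧ q = 0) ∨ ∃ j, q = j + 1 ∧ D j ≤ δ u ∧ δ u < 2 * D j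

lemma IsReached.size_le {k : ℕ} {v : Body d} {W : Finset (Body d)} (hW : IsReached S δ k v W)
    {u : Body d} (hu : u ∈ W) : δ v ≤ δ u := by
  obtain ⟨x, n, -, rfl, -, -, -, hδ⟩ := hW.exists_walk u hu
  exact hδ 0 (Nat.zero_le n)

/-- The lowest scale: the size of `v`, or the least positive size if `v` is a single point. -/
lemma IsReached.exists_base {k : ℕ} {v : Body d} {W : Finset (Body d)}
    (h : IsSizing S N b θ δ) (hW : IsReached S δ k v W) :
    ∃ D₀ : ℝ, 0 < D₀ ∧ δ v ≤ D₀ ∧ ∀ u ∈ W, 0 < δ u → D₀ ≤ δ u := by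
  classical
  rcases (h.nonneg v).eq_or_lt with h0 | h0
  · rcases (W.filter fun u => 0 < δ u).eq_empty_or_nonempty with he | hne
    · refine ⟨1, one_pos, h0 ▸ zero_le_one, fun u hu hpos => ?_⟩
      exact absurd (Finset.mem_filter.2 ⟨hu, hpos⟩) (he ▸ Finset.notMem_empty u)
    · obtain ⟨m, hm, hmin⟩ := Finset.exists_min_image _ δ hne
      have hpos := (Finset.mem_filter.1 hm).2
      exact ⟨δ m, hpos, h0 ▸ hpos.le, fun u hu hu0 => hmin u (Finset.mem_filter.2 ⟨hu, hu0⟩)⟩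
  · exact ⟨δ v, h0, le_rfl, fun u hu _ => hW.size_le hu⟩

lemma IsReached.card_le_sum {k : ℕ} {v : Body d} {W : Finset (Body d)}
    (h : IsSizing S N b θ δ) (hW : IsReached S δ k v W) {c : EuclideanSpace ℝ (Fin d)}
    (hc : c ∈ v) (hcv : ∀ y ∈ v, N (y - c) ≤ θ * δ v) {D₀ : ℝ} (hD₀ : 0 < D₀)
    (hD₀W : ∀ u ∈ W, 0 < δ u → D₀ ≤ δ u) {L : ℕ} (hL : 1 ≤ L) (hk : k ≤ 2 ^ L)
    (R : ℕ → Finset ℕ)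
    (hR : ∀ a, ∀ q ∈ chainReach (LevelStep S N δ (dyadicScale D₀ L a) c (k - 1 + θ))
      (level (dyadicScale D₀ L a) (δ v)) k, q ∈ R a) [DecidableEq (Body d)]
    [∀ a q, DecidablePred (InOctave δ (dyadicScale D₀ L a) v q)] :
    W.card ≤ ∑ a ∈ Finset.range L, ∑ q ∈ R a,
      (W.filter (InOctave δ (dyadicScale D₀ L a) v q)).card := by
  have hsub : W ⊆ (Finset.range L).biUnion fun a => (R a).biUnion fun q =>
      W.filter (InOctave δ (dyadicScale D₀ L a) v q) := by
    intro u hu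
    simp only [Finset.mem_biUnion, Finset.mem_filter, Finset.mem_range]
    rcases (h.nonneg u).eq_or_lt with h0 | h0
    · have huv := hW.eq_of_zero u hu h0.symm
      have hlev : level (dyadicScale D₀ L 0) (δ v) = 0 := by
        refine Nat.le_zero.1 (level_le ?_)
        rw [← huv, ← h0]
        exact (isScale_dyadicScale hD₀ hL hk 0).pos 0
      exact ⟨0, hL, 0, hR 0 0 (by rw [hlev]; exact self_mem_chainReach k), hu, Or.inl ⟨huv, rfl⟩⟩
    · obtain ⟨a, ha, j, hj1, hj2⟩ := exists_dyadicScale hD₀ (hD₀W u hu h0) hL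
      have hD := isScale_dyadicScale hD₀ hL hk a
      refine ⟨a, ha, j + 1, hR a (j + 1) ?_, hu, Or.inr ⟨j, rfl, hj1, hj2⟩⟩
      have hlev := hD.level_eq hj1 (hj2.trans_le (hD.two_mul_le j))
      obtain ⟨x, n, hn, rfl, rfl, hxS, hx, hδ⟩ := hW.exists_walk u hu
      have hsup : (Finset.range (n + 1)).sup
          (fun i => level (dyadicScale D₀ L a) (δ (x i))) = j + 1 := by
        rw [← hlev]
        refine le_antisymm (Finset.sup_le fun i hi => hD.level_mono (hδ i ?_)) ?_
        · exact Nat.lt_succ_iff.1 (Finset.mem_range.1 hi)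
        · exact Finset.le_sup (f := fun i => level (dyadicScale D₀ L a) (δ (x i)))
            (Finset.self_mem_range_succ n)
      rw [← hsup]
      exact chainReach_mono hn (h.sup_level_mem_chainReach hD hc hcv hxS n hn hx)
  refine (Finset.card_le_card hsub).trans (Finset.card_biUnion_le.trans ?_)
  exact Finset.sum_le_sum fun a _ => Finset.card_biUnion_le

lemma IsReached.card_octave_le {t k : ℕ} (ht : 1 ≤ t) (hk : 1 ≤ k) (hS : IsThin t S) {v : Body d}
    {W : Finset (Body d)} (h : IsSizing S N b θ δ) (hW : IsReached S δ k v W)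
    {c : EuclideanSpace ℝ (Fin d)} (hc : c ∈ v) (hcv : ∀ y ∈ v, N (y - c) ≤ θ * δ v) {D : ℕ → ℝ}
    (hD : IsScale k D) (hDv : ∀ j, δ v ≤ D j) (q : ℕ) [DecidablePred (InOctave δ D v q)] :
    ((W.filter (InOctave δ D v q)).card : ℝ) ≤ t * b * (4 * k - 2 + 2 * θ) ^ d := by
  have hk' : (1 : ℝ) ≤ k := by exact_mod_cast hk
  have ht' : (1 : ℝ) ≤ t := by exact_mod_cast ht
  have hθ := h.theta_nonneg
  cases q with
  | zero =>
    have hsub : W.filter (InOctave δ D v 0) ⊆ {v} := by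
      intro u hu
      rcases (Finset.mem_filter.1 hu).2 with h1 | ⟨j, hj, -⟩
      · exact Finset.mem_singleton.2 h1.1
      · omega
    have h1 : ((W.filter (InOctave δ D v 0)).card : ℝ) ≤ 1 := by
      exact_mod_cast (Finset.card_le_card hsub)
    refine h1.trans (one_le_mul_of_one_le_of_one_le
      (one_le_mul_of_one_le_of_one_le ht' h.one_le) (one_le_pow₀ (by linarith)))
  | succ j =>
    have hDj := hD.pos j
    have hoct : ∀ u ∈ W.filter (InOctave δ D v (j + 1)), D j ≤ δ u ∧ δ u < 2 * D j := by
      intro u hu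
      rcases (Finset.mem_filter.1 hu).2 with ⟨-, h1⟩ | ⟨i, hi, h1⟩
      · omega
      · obtain rfl : j = i := by omega
        exact h1
    have key := h.card_le hS ((Finset.filter_subset _ _).trans hW.subset) c
      (r := (θ + 2 * (k - 1)) * D j) hDj
      (mul_nonneg (by linarith) hDj.le) (fun u hu => (hoct u hu).1) (fun u hu => by
        obtain ⟨x, n, hn, rfl, rfl, hxS, hx, hδ⟩ := hW.exists_walk u (Finset.mem_filter.1 hu).1
        obtain ⟨y, hy, hyc⟩ := h.exists_seminorm_sub_le hc hcv hxS n hx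
        refine ⟨y, hy, hyc.trans ?_⟩
        have hsum : ∑ i ∈ Finset.Ico 1 n, δ (x i) ≤ (n - 1 : ℕ) * (2 * D j) := by
          refine (Finset.sum_le_card_nsmul _ _ (2 * D j) fun i hi => ?_).trans_eq (by simp)
          exact (hδ i (Finset.mem_Ico.1 hi).2.le).trans (hoct _ hu).2.le
        have hnk : ((n - 1 : ℕ) : ℝ) ≤ k - 1 := by
          rw [le_sub_iff_add_le]
          exact_mod_cast (by omega : n - 1 + 1 ≤ k)
        have h1 := mul_le_mul_of_nonneg_left (hDv j) hθ
        have h2 := mul_le_mul_of_nonneg_right hnk (by linarith : 0 ≤ 2 * D j)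
        linarith)
    refine key.trans_eq ?_
    congr 2
    field_simp
    ring

lemma chainReach_toFinset {A : ℕ → ℕ → Prop} (hA : ∀ i j q, i ≤ j → j < q → A i q → A j q)
    {s : ℕ} {p : ℕ} (hs : ∀ i, p ≤ i → {q | i < q ∧ A i q}.encard ≤ s) :
    ∃ F : ℕ → Finset ℕ, (∀ k, (F k : Set ℕ) = chainReach A p k) ∧
      ∀ k, (F k).card ≤ (k + s).choose s := by
  have hle := fun k => encard_chainReach_le s A hA k p hs
  have hfin := fun k => Set.finite_of_encard_le_coe (hle k)
  refine ⟨fun k => (hfin k).toFinset, fun k => (hfin k).coe_toFinset, fun k => ?_⟩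
  have := hle k
  rw [(hfin k).encard_eq_coe_toFinset_card] at this
  exact_mod_cast this

/-- With `e` levels set apart, and at most `m` objects of sizes above these that are close to `c`,
the number of levels is at most `(k + (e + m)).choose (e + m)` for each of the `L` scales. -/
lemma IsReached.card_le {t k L e m : ℕ} (ht : 1 ≤ t) (hk : 1 ≤ k) (hL : 1 ≤ L) (hkL : k ≤ 2 ^ L)
    (hS : IsThin t S) {v : Body d} {W : Finset (Body d)} (h : IsSizing S N b θ δ)
    (hW : IsReached S δ k v W) {c : EuclideanSpace ℝ (Fin d)} (hc : c ∈ v)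
    (hcv : ∀ y ∈ v, N (y - c) ≤ θ * δ v)
    (hm : ∀ D, IsScale k D → ∀ i, ∀ F ⊆ S, (∀ u ∈ F, D (i + e) ≤ δ u) →
      (∀ u ∈ F, ∃ y ∈ u, N (y - c) ≤ (k - 1 + θ) * D i) → F.card ≤ m) :
    (W.card : ℝ) ≤ t * b * L * (4 * k - 2 + 2 * θ) ^ d * (k + (e + m)).choose (e + m) := by
  classical
  have hk' : (1 : ℝ) ≤ k := by exact_mod_cast hk
  have hθ := h.theta_nonneg
  have hb := h.one_le
  obtain ⟨D₀, hD₀, hD₀v, hD₀W⟩ := hW.exists_base h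
  have hD := isScale_dyadicScale hD₀ hL hkL
  choose F hF hFcard using fun a => chainReach_toFinset (s := e + m)
    (p := level (dyadicScale D₀ L a) (δ v))
    (LevelStep.mono (S := S) (N := N) (δ := δ) (hD a) (c := c) (ρ := k - 1 + θ) (by linarith))
    (fun i _ => encard_levelStep_le i (hm _ (hD a) i))
  have h1 := hW.card_le_sum h hc hcv hD₀ hD₀W hL hkL (fun a => F a k)
    (fun a q hq => by rw [← Finset.mem_coe, hF]; exact hq)
  set T := (t : ℝ) * b * (4 * k - 2 + 2 * θ) ^ d with hT
  have hT0 : 0 ≤ T := by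
    have : 0 ≤ 4 * (k : ℝ) - 2 + 2 * θ := by linarith
    positivity
  calc (W.card : ℝ) ≤ ∑ a ∈ Finset.range L, ∑ q ∈ F a k,
        ((W.filter (InOctave δ (dyadicScale D₀ L a) v q)).card : ℝ) := by exact_mod_cast h1
    _ ≤ ∑ a ∈ Finset.range L, ∑ q ∈ F a k, T := by
        refine Finset.sum_le_sum fun a _ => Finset.sum_le_sum fun q _ => ?_
        exact hW.card_octave_le ht hk hS h hc hcv (hD a)
          (fun j => hD₀v.trans (le_dyadicScale hD₀.le L a j)) q
    _ ≤ ∑ a ∈ Finset.range L, (k + (e + m)).choose (e + m) * T := by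
        refine Finset.sum_le_sum fun a _ => ?_
        rw [Finset.sum_const, nsmul_eq_mul]
        exact mul_le_mul_of_nonneg_right (by exact_mod_cast hFcard a k) hT0
    _ = _ := by
        rw [Finset.sum_const, Finset.card_range, nsmul_eq_mul, hT]
        ring

end Walks

/-- The objects weakly `k`-reachable from `v` for a sizewise ordering. -/
lemma exists_isReached {S : Finset (Body d)} {N : Seminorm ℝ (EuclideanSpace ℝ (Fin d))} {b θ : ℝ}
    {δ : Body d → ℝ} (h : IsSizing S N b θ δ) {prec : S → S → Prop} (hprec : IsSizewise S prec)
    (k : ℕ) (v : S) : ∃ W : Finset (Body d), IsReached S δ k v W ∧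
      W.card = (weakReach (intersectionGraph S) prec k v).ncard := by
  classical
  refine ⟨(weakReach (intersectionGraph S) prec k v).toFinset.map (Function.Embedding.subtype _),
    ?_, by rw [Finset.card_map, Set.ncard_eq_toFinset_card']⟩
  have hwalk : ∀ u : S, u ∈ weakReach (intersectionGraph S) prec k v →
      ∃ p : (intersectionGraph S).Walk v u, p.length ≤ k ∧
        ∀ i ≤ p.length, δ (p.getVert i).1 ≤ δ u.1 := by
    rintro u ⟨huv, p, -, hpk, hp⟩
    have hle : ∀ y : S, prec u y → δ y.1 ≤ δ u.1 := fun y hy =>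
      h.mono u u.2 y y.2 (hprec.2 u y hy)
    refine ⟨p, hpk, fun i _ => ?_⟩
    by_cases h1 : p.getVert i = u
    · rw [h1]
    · by_cases h2 : p.getVert i = v
      · rw [h2] at h1 ⊢
        rcases huv with huv | huv
        · exact absurd huv.symm h1
        · exact hle v huv
      · exact hle _ (hp _ (p.getVert_mem_support i) h2 h1)
  refine ⟨?_, ?_, ?_⟩
  · intro u hu
    obtain ⟨u', -, rfl⟩ := Finset.mem_map.1 hu
    exact u'.2
  · intro u hu hu0
    obtain ⟨u', hu', rfl⟩ := Finset.mem_map.1 hu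
    obtain ⟨p, -, hp⟩ := hwalk u' (Set.mem_toFinset.1 hu')
    cases p with
    | nil => rfl
    | @cons _ w _ hadj p =>
      -- Two single points that meet are equal, so that a walk through single points is trivial.
      exfalso
      have h0 : ∀ y : S, δ y.1 ≤ δ u'.1 → δ y.1 = 0 := fun y hy =>
        le_antisymm (hy.trans_eq hu0) (h.nonneg _)
      have hv0 := h0 v (by simpa using hp 0 (Nat.zero_le _))
      have hw0 := h0 w (by simpa using hp 1 (by simp))
      obtain ⟨hne, z, hzv, hzw⟩ := hadj
      refine hne (Subtype.ext (ConvexBody.ext (Set.ext fun y => ?_)))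
      constructor
      · intro hy
        rw [h.eq_of_zero v v.2 hv0 y hy z hzv]
        exact hzw
      · intro hy
        rw [h.eq_of_zero w w.2 hw0 y hy z hzw]
        exact hzv
  · intro u hu
    obtain ⟨u', hu', rfl⟩ := Finset.mem_map.1 hu
    obtain ⟨p, hpk, hp⟩ := hwalk u' (Set.mem_toFinset.1 hu')
    refine ⟨fun i => (p.getVert i).1, p.length, hpk, by simp, by simp, fun i => (p.getVert i).2,
      fun i hi => (p.adj_getVert_succ hi).2, hp⟩

/-! ### Homothets, ball-like objects and balls -/

lemma closedBall_volume_pos :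
    0 < volume.real ((normSeminorm ℝ (EuclideanSpace ℝ (Fin d))).closedBall 0 1) := by
  rw [closedBall_normSeminorm, measureReal_def]
  exact ENNReal.toReal_pos (Metric.measure_closedBall_pos _ _ one_pos).ne'
    measure_closedBall_lt_top.ne

lemma volume_real_closedBall (hd : 1 ≤ d) (c : EuclideanSpace ℝ (Fin d)) {r : ℝ} (hr : 0 ≤ r) :
    volume.real (Metric.closedBall c r) =
      r ^ d * volume.real ((normSeminorm ℝ (EuclideanSpace ℝ (Fin d))).closedBall 0 1) := by
  rcases hr.eq_or_lt with rfl | hr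
  · have : Nonempty (Fin d) := ⟨⟨0, hd⟩⟩
    rw [Metric.closedBall_zero, measureReal_def, measure_singleton, zero_pow (by omega), zero_mul,
      ENNReal.toReal_zero]
  · rw [← closedBall_normSeminorm ℝ, seminorm_closedBall_eq_image _ _ hr,
      volume_real_add_smul _ hr.le]

lemma norm_sub_le_diam (u : Body d) {x y : EuclideanSpace ℝ (Fin d)} (hx : x ∈ u) (hy : y ∈ u) :
    ‖x - y‖ ≤ Metric.diam (u : Set (EuclideanSpace ℝ (Fin d))) := by
  rw [← dist_eq_norm]
  exact Metric.dist_le_diam_of_mem u.isCompact.isBounded hx hy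

lemma isSizing_of_isBallLike (hd : 1 ≤ d) {S : Finset (Body d)} {b : ℝ} (hb : 1 ≤ b)
    (hS : ∀ u ∈ S, IsBallLike b u) :
    IsSizing S (normSeminorm ℝ (EuclideanSpace ℝ (Fin d))) b 1
      (fun u => Metric.diam (u : Set (EuclideanSpace ℝ (Fin d)))) where
  volume_pos := closedBall_volume_pos
  one_le := hb
  theta_nonneg := zero_le_one
  theta_le_one := le_rfl
  nonneg _ := Metric.diam_nonneg
  seminorm_sub_le u _ _ hx _ hy := norm_sub_le_diam u hx hy
  exists_center u _ := by
    obtain ⟨c, hc⟩ := u.nonempty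
    exact ⟨c, hc, fun x hx => (norm_sub_le_diam u hx hc).trans_eq (one_mul _).symm⟩
  volume_le u hu := by
    rw [← volume_real_closedBall hd 0 (div_nonneg Metric.diam_nonneg zero_le_two)]
    exact hS u hu
  mono _ _ _ _ h := h
  eq_of_zero u _ h0 x hx y hy := by
    refine sub_eq_zero.1 (norm_le_zero_iff.1 ?_)
    exact (norm_sub_le_diam u hx hy).trans_eq h0

lemma isSizing_of_isBall (hd : 1 ≤ d) {S : Finset (Body d)} (hS : ∀ u ∈ S, IsBall u) :
    IsSizing S (normSeminorm ℝ (EuclideanSpace ℝ (Fin d))) 1 (1 / 2)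
      (fun u => Metric.diam (u : Set (EuclideanSpace ℝ (Fin d)))) := by
  have : Nonempty (Fin d) := ⟨⟨0, hd⟩⟩
  have hdiam : ∀ u ∈ S, ∃ (c : EuclideanSpace ℝ (Fin d)), (u : Set (EuclideanSpace ℝ (Fin d))) =
      Metric.closedBall c (Metric.diam (u : Set (EuclideanSpace ℝ (Fin d))) / 2) := by
    intro u hu
    obtain ⟨c, r, hr, hur⟩ := hS u hu
    refine ⟨c, ?_⟩
    rw [hur, Metric.diam_closedBall_eq c hr.le, mul_div_cancel_left₀ r two_ne_zero]
  have h := isSizing_of_isBallLike hd (S := S) le_rfl fun u hu => by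
    obtain ⟨c, hc⟩ := hdiam u hu
    have h0 : 0 ≤ Metric.diam (u : Set (EuclideanSpace ℝ (Fin d))) / 2 :=
      div_nonneg Metric.diam_nonneg zero_le_two
    have hvol := congrArg volume.real hc
    rw [volume_real_closedBall hd c h0, ← volume_real_closedBall hd 0 h0] at hvol
    rw [IsBallLike, div_one]
    exact hvol.ge
  exact
    { h with
      theta_nonneg := by norm_num
      theta_le_one := by norm_num
      exists_center := fun u hu => by
        obtain ⟨c, hc⟩ := hdiam u hu
        have hmem : ∀ x, x ∈ u ↔ ‖x - c‖ ≤ 1 / 2 * Metric.diam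
            (u : Set (EuclideanSpace ℝ (Fin d))) := fun x =>
          (Set.ext_iff.1 hc x).trans (by rw [mem_closedBall_iff_norm, one_div_mul_eq_div])
        refine ⟨c, (hmem c).2 ?_, fun x hx => (hmem x).1 hx⟩
        rw [sub_self, norm_zero]
        exact mul_nonneg (by norm_num) Metric.diam_nonneg }

open scoped Pointwise in
lemma diam_add_smul_image (a : EuclideanSpace ℝ (Fin d)) {r : ℝ} (hr : 0 ≤ r)
    (s : Set (EuclideanSpace ℝ (Fin d))) :
    Metric.diam ((fun x => a + r • x) '' s) = r * Metric.diam s := by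
  have : (fun x => a + r • x) '' s = (fun x => a + x) '' (r • s) := by
    rw [← Set.image_smul, Set.image_image]
  rw [this, (isometry_add_left a).diam_image, diam_smul₀, Real.norm_of_nonneg hr]

/-- A centrally symmetric body with nonempty interior is the closed unit ball of a seminorm around
its center of symmetry. -/
lemma exists_seminorm_of_isCentrallySymmetric {K : Body d}
    (hK : (interior (K : Set (EuclideanSpace ℝ (Fin d)))).Nonempty)
    (hsymm : IsCentrallySymmetric K) :
    ∃ (N : Seminorm ℝ (EuclideanSpace ℝ (Fin d))) (c : EuclideanSpace ℝ (Fin d)),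
      c ∈ K ∧ (∀ x, x ∈ K ↔ N (x - c) ≤ 1) ∧
      volume.real (N.closedBall 0 1) = volume.real (K : Set (EuclideanSpace ℝ (Fin d))) := by
  obtain ⟨c, hc⟩ := hsymm
  obtain ⟨x, hx⟩ := hK
  have hcint : c ∈ interior (K : Set (EuclideanSpace ℝ (Fin d))) := by
    have h := K.convex.combo_interior_self_mem_interior hx (hc x (interior_subset hx))
      (a := 1 / 2) (b := 1 / 2) (by norm_num) (by norm_num) (by norm_num)
    convert h using 1
    module
  set s : Set (EuclideanSpace ℝ (Fin d)) := (fun x => c + x) ⁻¹' K with hs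
  have hconv : Convex ℝ s := K.convex.translate_preimage_right c
  have hcont : Continuous fun x : EuclideanSpace ℝ (Fin d) => c + x := by fun_prop
  have hnhds : s ∈ nhds (0 : EuclideanSpace ℝ (Fin d)) := by
    refine hcont.continuousAt.preimage_mem_nhds ?_
    rw [add_zero]
    exact mem_interior_iff_mem_nhds.1 hcint
  have hbal : Balanced ℝ s := (balanced_iff_neg_mem hconv).2 fun y hy => by
    have := hc _ hy
    have heq : (2 : ℝ) • c - (c + y) = c + -y := by module
    rw [heq] at this
    exact this
  have hclosed : IsClosed s := K.isClosed.preimage hcont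
  have hle : ∀ y, gaugeSeminorm hbal hconv (absorbent_nhds_zero hnhds) y ≤ 1 ↔ y ∈ s := fun y => by
    rw [gaugeSeminorm_toFun, gauge_le_one_iff_mem_closure hconv hnhds, hclosed.closure_eq]
  refine ⟨gaugeSeminorm hbal hconv (absorbent_nhds_zero hnhds), c, interior_subset hcint,
    fun y => ?_, ?_⟩
  · rw [hle, hs, Set.mem_preimage, add_sub_cancel]
    rfl
  · have : (gaugeSeminorm hbal hconv (absorbent_nhds_zero hnhds)).closedBall 0 1 = s := by
      ext y
      rw [Seminorm.mem_closedBall_zero, hle]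
    rw [this, hs, measureReal_def, measureReal_def, measure_preimage_add]

lemma exists_isSizing_of_isHomothetFamily (hd : 1 ≤ d) {S : Finset (Body d)}
    (hS : IsHomothetFamily S) : ∃ N δ, IsSizing S N 1 (1 / 2) δ := by
  obtain ⟨K, hKint, hKsymm, hKS⟩ := hS
  obtain ⟨N, c, hcK, hNK, hvol⟩ := exists_seminorm_of_isCentrallySymmetric hKint hKsymm
  have : Nonempty (Fin d) := ⟨⟨0, hd⟩⟩
  have hKdiam : 0 < Metric.diam (K : Set (EuclideanSpace ℝ (Fin d))) := by
    obtain ⟨x, hx⟩ := hKint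
    obtain ⟨ε, hε, hball⟩ := Metric.isOpen_iff.1 isOpen_interior x hx
    have h1 := Metric.diam_mono (hball.trans interior_subset) K.isCompact.isBounded
    rw [Metric.diam_ball_eq x hε.le] at h1
    linarith
  have hVpos : 0 < volume.real (K : Set (EuclideanSpace ℝ (Fin d))) :=
    ENNReal.toReal_pos (Measure.measure_pos_of_nonempty_interior _ hKint).ne' K.isCompact.measure_ne_top
  have hsize : ∀ u ∈ S, ∃ (a : EuclideanSpace ℝ (Fin d)) (r : ℝ), 0 < r ∧
      (u : Set (EuclideanSpace ℝ (Fin d))) = (fun x => a + r • x) '' K ∧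
      2 * Metric.diam (u : Set (EuclideanSpace ℝ (Fin d))) /
        Metric.diam (K : Set (EuclideanSpace ℝ (Fin d))) = 2 * r := by
    intro u hu
    obtain ⟨a, r, hr, hur⟩ := hKS u hu
    refine ⟨a, r, hr, hur, ?_⟩
    rw [hur, diam_add_smul_image a hr.le]
    field_simp
  have hsub : ∀ (a : EuclideanSpace ℝ (Fin d)) {r : ℝ} (_ : 0 < r) (x y : EuclideanSpace ℝ (Fin d)),
      N (a + r • x - (a + r • y)) = r * N (x - y) := fun a r hr x y => by
    rw [add_sub_add_left_eq_sub, ← smul_sub, map_smul_eq_mul, Real.norm_of_nonneg hr.le]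
  refine ⟨N, fun u => 2 * Metric.diam (u : Set (EuclideanSpace ℝ (Fin d))) /
    Metric.diam (K : Set (EuclideanSpace ℝ (Fin d))), ?_, le_rfl, by norm_num, by norm_num,
    fun u => by have := Metric.diam_nonneg (s := (u : Set (EuclideanSpace ℝ (Fin d)))); positivity,
    ?_, ?_, ?_, ?_, ?_⟩
  · rw [hvol]; exact hVpos
  · intro u hu x hx y hy
    obtain ⟨a, r, hr, hur, hδ⟩ := hsize u hu
    rw [← SetLike.mem_coe, hur] at hx hy
    obtain ⟨x, hx, rfl⟩ := hx
    obtain ⟨y, hy, rfl⟩ := hy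
    rw [hδ, hsub a hr, mul_comm 2 r]
    refine mul_le_mul_of_nonneg_left ?_ hr.le
    calc N (x - y) = N ((x - c) - (y - c)) := by rw [sub_sub_sub_cancel_right]
      _ ≤ N (x - c) + N (y - c) := map_sub_le_add N _ _
      _ ≤ 1 + 1 := add_le_add ((hNK x).1 hx) ((hNK y).1 hy)
      _ = 2 := by norm_num
  · intro u hu
    obtain ⟨a, r, hr, hur, hδ⟩ := hsize u hu
    refine ⟨a + r • c, ?_, ?_⟩
    · rw [← SetLike.mem_coe, hur]
      exact ⟨c, hcK, rfl⟩
    · intro x hx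
      rw [← SetLike.mem_coe, hur] at hx
      obtain ⟨x, hx, rfl⟩ := hx
      rw [hδ, hsub a hr, one_div, inv_mul_cancel_left₀ two_ne_zero]
      exact mul_le_of_le_one_right hr.le ((hNK x).1 hx)
  · intro u hu
    obtain ⟨a, r, hr, hur, hδ⟩ := hsize u hu
    rw [hδ, hvol, hur, volume_real_add_smul a hr.le, mul_div_cancel_left₀ r two_ne_zero, div_one]
  · intro u _ v _ huv
    gcongr
  · intro u hu h0
    obtain ⟨a, r, hr, -, hδ⟩ := hsize u hu
    linarith

lemma wcol_le_of_isReached {S : Finset (Body d)} {N : Seminorm ℝ (EuclideanSpace ℝ (Fin d))}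
    {b θ : ℝ} {δ : Body d → ℝ} (h : IsSizing S N b θ δ) {prec : S → S → Prop}
    (hprec : IsSizewise S prec) (k : ℕ) {X : ℝ} (hX : 0 ≤ X)
    (hW : ∀ v ∈ S, ∀ W, IsReached S δ k v W → (W.card : ℝ) ≤ X) :
    (wcol (intersectionGraph S) prec k : ℝ) ≤ X := by
  rw [← Nat.le_floor_iff hX]
  refine Finset.sup_le fun v _ => ?_
  obtain ⟨W, hvW, hcard⟩ := exists_isReached h hprec k v
  rw [← hcard]
  exact Nat.le_floor (hW v v.2 W hvW)

lemma le_two_pow_max_ceil_logb {k : ℕ} (hk : 1 ≤ k) : k ≤ 2 ^ max 1 ⌈Real.logb 2 (k : ℝ)⌉₊ := by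
  have hk' : (0 : ℝ) < k := by exact_mod_cast hk
  have h : (k : ℝ) ≤ 2 ^ (max 1 ⌈Real.logb 2 (k : ℝ)⌉₊) := by
    rw [← Real.rpow_natCast, ← Real.logb_le_iff_le_rpow one_lt_two hk']
    exact (Nat.le_ceil _).trans (by exact_mod_cast le_max_right _ _)
  exact_mod_cast h

lemma choose_add_mono (k : ℕ) : Monotone fun s => (k + s).choose s := fun s s' h => by
  simp only [← Nat.choose_symm_add]
  exact Nat.choose_le_choose k (Nat.add_le_add_left h k)

/-- In every setting with a sizing, the weak coloring number is bounded by packing alone. -/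
lemma IsSizing.wcol_le {S : Finset (Body d)} {N : Seminorm ℝ (EuclideanSpace ℝ (Fin d))}
    {b θ : ℝ} {δ : Body d → ℝ} (h : IsSizing S N b θ δ) {t k : ℕ} (ht : 1 ≤ t) (hS : IsThin t S)
    {prec : S → S → Prop} (hprec : IsSizewise S prec) (hk : 1 ≤ k) {s : ℕ}
    (hs : 1 + ⌊(t : ℝ) * b * 4 ^ d⌋₊ ≤ s) :
    (wcol (intersectionGraph S) prec k : ℝ) ≤
      t * b * (max 1 ⌈Real.logb 2 (k : ℝ)⌉₊ : ℕ) * (4 * k - 2 + 2 * θ) ^ d * (k + s).choose s := by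
  have hk' : (1 : ℝ) ≤ k := by exact_mod_cast hk
  have hθ := h.theta_nonneg
  have hθ1 := h.theta_le_one
  have hb := h.one_le
  have hbase : 0 ≤ 4 * (k : ℝ) - 2 + 2 * θ := by linarith
  refine wcol_le_of_isReached h hprec k (by positivity) fun v hv W hW => ?_
  obtain ⟨c, hc, hcv⟩ := h.exists_center v hv
  refine (hW.card_le ht hk (le_max_left _ _) (le_two_pow_max_ceil_logb hk) hS h hc hcv (e := 1)
    (m := ⌊(t : ℝ) * b * 4 ^ d⌋₊) ?_).trans ?_
  · intro D hD i F hF hFD hFc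
    refine Nat.le_floor ?_
    have hDi := hD.pos i
    have hDi' := hD.pos (i + 1)
    have hle : (k - 1 + θ) * D i ≤ D (i + 1) :=
      (mul_le_mul_of_nonneg_right (by linarith) hDi.le).trans (hD.mul_le i)
    have h0 : 0 ≤ (k - 1 + θ) * D i := mul_nonneg (by linarith) hDi.le
    refine (h.card_le hS hF c hDi' h0 hFD hFc).trans ?_
    gcongr
    rw [div_le_iff₀ hDi']
    linarith
  · have h1 : ((k + (1 + ⌊(t : ℝ) * b * 4 ^ d⌋₊)).choose (1 + ⌊(t : ℝ) * b * 4 ^ d⌋₊) : ℝ) ≤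
        (k + s).choose s := by exact_mod_cast choose_add_mono k hs
    gcongr

lemma wcol_le_of_isHomothetFamily (hd : 1 ≤ d) {t k : ℕ} (ht : 1 ≤ t) {S : Finset (Body d)}
    (hS : IsThin t S) {prec : S → S → Prop} (hprec : IsSizewise S prec) (hk : 1 ≤ k)
    (hhom : IsHomothetFamily S) :
    wcol (intersectionGraph S) prec k ≤
      t * max 1 ⌈Real.logb 2 (k : ℝ)⌉₊ * (4 * k - 1) ^ d *
        Nat.choose (k + t * 5 ^ d + 2) (t * 5 ^ d + 2) := by
  obtain ⟨N, δ, h⟩ := exists_isSizing_of_isHomothetFamily hd hhom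
  have key := h.wcol_le ht hS hprec hk (s := t * 5 ^ d + 2) (by
    rw [show (t : ℝ) * 1 * 4 ^ d = ((t * 4 ^ d : ℕ) : ℝ) by push_cast; ring, Nat.floor_natCast]
    have : t * 4 ^ d ≤ t * 5 ^ d := Nat.mul_le_mul_left t (Nat.pow_le_pow_left (by norm_num) d)
    omega)
  rw [← Nat.cast_le (α := ℝ)]
  push_cast [Nat.cast_sub (by omega : 1 ≤ 4 * k)]
  refine key.trans_eq ?_
  rw [show 4 * (k : ℝ) - 2 + 2 * (1 / 2) = 4 * k - 1 by ring, ← add_assoc k]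
  push_cast
  ring

lemma wcol_le_of_isBallLike (hd : 1 ≤ d) {t k : ℕ} (ht : 1 ≤ t) {S : Finset (Body d)}
    (hS : IsThin t S) {prec : S → S → Prop} (hprec : IsSizewise S prec) (hk : 1 ≤ k) {b : ℝ}
    (hb : 1 ≤ b) (hball : ∀ u ∈ S, IsBallLike b u) :
    (wcol (intersectionGraph S) prec k : ℝ) ≤
      (t : ℝ) * b * (max 1 ⌈Real.logb 2 (k : ℝ)⌉₊ : ℕ) * (4 * (k : ℝ)) ^ d *
        (Nat.choose (k + ⌊(t : ℝ) * b * 6 ^ d⌋₊ + 2) (⌊(t : ℝ) * b * 6 ^ d⌋₊ + 2) : ℕ) := by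
  have key := (isSizing_of_isBallLike hd hb hball).wcol_le ht hS hprec hk
    (s := ⌊(t : ℝ) * b * 6 ^ d⌋₊ + 2) (by
      have : ⌊(t : ℝ) * b * 4 ^ d⌋₊ ≤ ⌊(t : ℝ) * b * 6 ^ d⌋₊ := by
        refine Nat.floor_le_floor ?_
        gcongr
        norm_num
      omega)
  refine key.trans_eq ?_
  rw [show 4 * (k : ℝ) - 2 + 2 * 1 = 4 * k by ring, ← add_assoc k]

/-! ### The refined bound and balls -/

section Refined

variable {S : Finset (Body d)} {N : Seminorm ℝ (EuclideanSpace ℝ (Fin d))} {b θ : ℝ}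
  {δ : Body d → ℝ}

/-- A walk of length at most `k` that needs `f` edges to come within one level of its end has only
`k - f` edges left to move away from `c` by steps comparable to the size of its end. -/
lemma IsReached.exists_level_near {k : ℕ} (hk : 1 ≤ k) {v : Body d} {W : Finset (Body d)}
    (h : IsSizing S N b θ δ) (hW : IsReached S δ k v W) {c : EuclideanSpace ℝ (Fin d)}
    (hc : c ∈ v) (hcv : ∀ y ∈ v, N (y - c) ≤ θ * δ v) {D : ℕ → ℝ} (hD : IsScale k D)
    (hDv : ∀ j, δ v ≤ D j) {u : Body d} (hu : u ∈ W) {j : ℕ} (h1 : D j ≤ δ u)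
    (h2 : δ u < 2 * D j) :
    ∃ q f, f ≤ k ∧ q ∈ chainReach (LevelStep S N δ D c (k - 1 + θ)) (level D (δ v)) f ∧
      (q = j + 1 ∨ q + 1 = j + 1) ∧
      ∃ y ∈ u, N (y - c) ≤ (θ + 1 + 2 * ((k - f : ℕ) : ℝ)) * D j := by
  classical
  have hk' : (1 : ℝ) ≤ k := by exact_mod_cast hk
  obtain ⟨x, n, hn, rfl, rfl, hxS, hx, hδ⟩ := hW.exists_walk u hu
  have hlev := hD.level_eq h1 (h2.trans_le (hD.two_mul_le j))
  have hex : ∃ i, j ≤ level D (δ (x i)) := ⟨n, by omega⟩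
  set f := Nat.find hex with hf
  have hfn : f ≤ n := Nat.find_min' hex (by omega)
  have hflev : j ≤ level D (δ (x f)) := Nat.find_spec hex
  have hlt : ∀ i < f, level D (δ (x i)) < j := fun i hi => not_le.1 (Nat.find_min hex hi)
  have hDj := hD.pos j
  have hsup : (Finset.range (f + 1)).sup (fun i => level D (δ (x i))) = level D (δ (x f)) := by
    refine le_antisymm (Finset.sup_le fun i hi => ?_)
      (Finset.le_sup (f := fun i => level D (δ (x i))) (Finset.self_mem_range_succ f))
    rcases (Nat.lt_succ_iff.1 (Finset.mem_range.1 hi)).eq_or_lt with rfl | hi'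
    · exact le_rfl
    · exact (hlt i hi').le.trans hflev
  have hmem := h.sup_level_mem_chainReach hD hc hcv hxS f (hfn.trans hn)
    fun i hi => hx i (hi.trans_le hfn)
  rw [hsup] at hmem
  have hup : level D (δ (x f)) ≤ j + 1 := hlev ▸ hD.level_mono (hδ f hfn)
  refine ⟨_, f, hfn.trans hn, hmem, by omega, ?_⟩
  obtain ⟨y, hy, hyc⟩ := h.exists_seminorm_sub_le hc hcv hxS n hx
  refine ⟨y, hy, hyc.trans ?_⟩
  -- Objects before index `f` have size at most `D j / k`, the others at most `2 * D j`.
  have hsmall : ∀ i < f, δ (x i) ≤ D j / k := fun i hi => by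
    have hij := hlt i hi
    obtain ⟨j, rfl⟩ : ∃ j', j = j' + 1 := ⟨j - 1, by omega⟩
    rw [le_div_iff₀ (by linarith), mul_comm]
    refine le_trans ?_ (hD.mul_le j)
    refine mul_le_mul_of_nonneg_left ?_ (by linarith)
    exact (hD.lt_level _).le.trans (hD.monotone (Nat.lt_succ_iff.1 hij))
  have hsum : ∑ i ∈ Finset.Ico 1 n, δ (x i) ≤ D j + (k - f : ℕ) * (2 * D j) := by
    calc ∑ i ∈ Finset.Ico 1 n, δ (x i) ≤ ∑ i ∈ Finset.range n, δ (x i) := by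
          refine Finset.sum_le_sum_of_subset_of_nonneg (fun i hi => ?_) fun i _ _ => h.nonneg _
          exact Finset.mem_range.2 (Finset.mem_Ico.1 hi).2
      _ = ∑ i ∈ Finset.range f, δ (x i) + ∑ i ∈ Finset.Ico f n, δ (x i) :=
          (Finset.sum_range_add_sum_Ico _ hfn).symm
      _ ≤ f * (D j / k) + (n - f : ℕ) * (2 * D j) := by
          refine add_le_add ?_ ?_
          · refine (Finset.sum_le_card_nsmul _ _ (D j / k) fun i hi => ?_).trans_eq (by simp)
            exact hsmall i (Finset.mem_range.1 hi)
          · refine (Finset.sum_le_card_nsmul _ _ (2 * D j) fun i hi => ?_).trans_eq (by simp)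
            exact (hδ i (Finset.mem_Ico.1 hi).2.le).trans h2.le
      _ ≤ D j + (k - f : ℕ) * (2 * D j) := by
          refine add_le_add ?_ ?_
          · rw [mul_div_assoc', div_le_iff₀ (by linarith), mul_comm]
            exact mul_le_mul_of_nonneg_left (by exact_mod_cast hfn.trans hn) hDj.le
          · refine mul_le_mul_of_nonneg_right ?_ (by linarith)
            exact_mod_cast Nat.sub_le_sub_right hn f
  have h3 := mul_le_mul_of_nonneg_left (hDv j) h.theta_nonneg
  linarith

lemma IsReached.card_octave_le_sum {t k : ℕ} (ht : 1 ≤ t) (hk : 1 ≤ k) (hS : IsThin t S)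
    {v : Body d} {W : Finset (Body d)} (h : IsSizing S N b θ δ) (hW : IsReached S δ k v W)
    {c : EuclideanSpace ℝ (Fin d)} (hc : c ∈ v) (hcv : ∀ y ∈ v, N (y - c) ≤ θ * δ v) {D : ℕ → ℝ}
    (hD : IsScale k D) (hDv : ∀ j, δ v ≤ D j) {F : ℕ → Finset ℕ}
    (hF : ∀ f, (F f : Set ℕ) = chainReach (LevelStep S N δ D c (k - 1 + θ)) (level D (δ v)) f)
    {q : ℕ} (hq : q ∈ F k) [DecidablePred (InOctave δ D v q)] :
    ((W.filter (InOctave δ D v q)).card : ℝ) ≤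
      ∑ p ∈ (F k).filter fun p => p = q ∨ p + 1 = q,
        t * b * (6 * ((k - sInf {f | p ∈ F f} : ℕ) + 1 : ℝ)) ^ d := by
  classical
  have ht' : (1 : ℝ) ≤ t := by exact_mod_cast ht
  have hb := h.one_le
  have hθ := h.theta_nonneg
  have hθ1 := h.theta_le_one
  cases q with
  | zero =>
    have hsub : W.filter (InOctave δ D v 0) ⊆ {v} := by
      intro u hu
      rcases (Finset.mem_filter.1 hu).2 with h1 | ⟨j, hj, -⟩
      · exact Finset.mem_singleton.2 h1.1
      · omega
    have h1 : ((W.filter (InOctave δ D v 0)).card : ℝ) ≤ 1 := by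
      exact_mod_cast (Finset.card_le_card hsub)
    refine h1.trans (le_trans ?_ (Finset.single_le_sum (fun p _ => by positivity)
      (Finset.mem_filter.2 ⟨hq, Or.inl rfl⟩)))
    refine one_le_mul_of_one_le_of_one_le (one_le_mul_of_one_le_of_one_le ht' hb)
      (one_le_pow₀ ?_)
    have : (0 : ℝ) ≤ ((k - sInf {f | 0 ∈ F f} : ℕ) : ℝ) := Nat.cast_nonneg _
    linarith
  | succ j =>
    have hDj := hD.pos j
    set near : ℕ → Finset (Body d) := fun p => W.filter fun u => D j ≤ δ u ∧
      ∃ y ∈ u, N (y - c) ≤ (θ + 1 + 2 * ((k - sInf {f | p ∈ F f} : ℕ) : ℝ)) * D j with hnear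
    have hsub : W.filter (InOctave δ D v (j + 1)) ⊆
        ((F k).filter fun p => p = j + 1 ∨ p + 1 = j + 1).biUnion near := by
      intro u hu
      obtain ⟨huW, ⟨-, h0⟩ | ⟨i, hi, h1, h2⟩⟩ := Finset.mem_filter.1 hu
      · omega
      obtain rfl : j = i := by omega
      obtain ⟨p, f, hfk, hp, hpj, y, hy, hyc⟩ :=
        hW.exists_level_near hk h hc hcv hD hDv huW h1 h2
      have hpf : p ∈ F f := by rw [← Finset.mem_coe, hF]; exact hp
      have hpk : p ∈ F k := by rw [← Finset.mem_coe, hF]; exact chainReach_mono hfk hp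
      have hinf : sInf {f | p ∈ F f} ≤ f := Nat.sInf_le hpf
      refine Finset.mem_biUnion.2 ⟨p, Finset.mem_filter.2 ⟨hpk, hpj⟩,
        Finset.mem_filter.2 ⟨huW, h1, y, hy, hyc.trans ?_⟩⟩
      have : ((k - f : ℕ) : ℝ) ≤ (k - sInf {f | p ∈ F f} : ℕ) := by
        exact_mod_cast Nat.sub_le_sub_left hinf k
      gcongr
    have hcard : ((W.filter (InOctave δ D v (j + 1))).card : ℝ) ≤
        ∑ p ∈ (F k).filter fun p => p = j + 1 ∨ p + 1 = j + 1, ((near p).card : ℝ) := by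
      exact_mod_cast (Finset.card_le_card hsub).trans Finset.card_biUnion_le
    refine hcard.trans (Finset.sum_le_sum fun p _ => ?_)
    have hx : (0 : ℝ) ≤ ((k - sInf {f | p ∈ F f} : ℕ) : ℝ) := Nat.cast_nonneg _
    refine (h.card_le hS ((Finset.filter_subset _ _).trans hW.subset) c
      (r := (θ + 1 + 2 * ((k - sInf {f | p ∈ F f} : ℕ) : ℝ)) * D j) hDj (by positivity)
      (fun u hu => (Finset.mem_filter.1 hu).2.1) (fun u hu => (Finset.mem_filter.1 hu).2.2)).trans ?_
    gcongr
    rw [div_le_iff₀ hDj]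
    nlinarith

/-- The refinement of the bound by the number of levels: a level reached only after `f` steps
accounts for a number of objects of order `(k - f + 1) ^ d` instead of `k ^ d`. -/
lemma IsReached.card_le_of_two_le {t k L e m : ℕ} (hd : 2 ≤ d) (ht : 1 ≤ t) (hk : 1 ≤ k)
    (hL : 1 ≤ L) (hkL : k ≤ 2 ^ L) (hS : IsThin t S) {v : Body d} {W : Finset (Body d)}
    (h : IsSizing S N b θ δ) (hW : IsReached S δ k v W) {c : EuclideanSpace ℝ (Fin d)}
    (hc : c ∈ v) (hcv : ∀ y ∈ v, N (y - c) ≤ θ * δ v)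
    (hm : ∀ D, IsScale k D → ∀ i, ∀ F ⊆ S, (∀ u ∈ F, D (i + e) ≤ δ u) →
      (∀ u ∈ F, ∃ y ∈ u, N (y - c) ≤ (k - 1 + θ) * D i) → F.card ≤ m) :
    (W.card : ℝ) ≤ t * b * L * (4 * 6 ^ d * (k + 1) ^ (d - 2)) *
      (k + (e + m) + 2).choose (e + m + 2) := by
  classical
  have hk' : (1 : ℝ) ≤ k := by exact_mod_cast hk
  have hθ := h.theta_nonneg
  have hb := h.one_le
  obtain ⟨D₀, hD₀, hD₀v, hD₀W⟩ := hW.exists_base h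
  have hD := isScale_dyadicScale hD₀ hL hkL
  choose F hF hFcard using fun a => chainReach_toFinset (s := e + m)
    (p := level (dyadicScale D₀ L a) (δ v))
    (LevelStep.mono (S := S) (N := N) (δ := δ) (hD a) (c := c) (ρ := k - 1 + θ) (by linarith))
    (fun i _ => encard_levelStep_le i (hm _ (hD a) i))
  have h1 := hW.card_le_sum h hc hcv hD₀ hD₀W hL hkL (fun a => F a k)
    (fun a q hq => by rw [← Finset.mem_coe, hF]; exact hq)
  have hFmono : ∀ a, Monotone (F a) := fun a f g hfg => by
    rw [← Finset.coe_subset, hF, hF]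
    exact chainReach_mono hfg
  set T : ℕ → ℕ → ℝ := fun a p => t * b * (6 * ((k - sInf {f | p ∈ F a f} : ℕ) + 1 : ℝ)) ^ d
    with hT
  have hT0 : ∀ a p, 0 ≤ T a p := fun a p => by simp only [hT]; positivity
  have hoct : ∀ a, ∑ q ∈ F a k,
      ((W.filter (InOctave δ (dyadicScale D₀ L a) v q)).card : ℝ) ≤ 2 * ∑ p ∈ F a k, T a p := by
    intro a
    calc ∑ q ∈ F a k, ((W.filter (InOctave δ (dyadicScale D₀ L a) v q)).card : ℝ)
        ≤ ∑ q ∈ F a k, ∑ p ∈ (F a k).filter fun p => p = q ∨ p + 1 = q, T a p :=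
          Finset.sum_le_sum fun q hq => hW.card_octave_le_sum ht hk hS h hc hcv (hD a)
            (fun j => hD₀v.trans (le_dyadicScale hD₀.le L a j)) (hF a) hq
      _ = ∑ p ∈ F a k, ∑ q ∈ (F a k).filter fun q => p = q ∨ p + 1 = q, T a p := by
          simp only [Finset.sum_filter]
          exact Finset.sum_comm
      _ ≤ ∑ p ∈ F a k, 2 * T a p := by
          refine Finset.sum_le_sum fun p _ => ?_
          rw [Finset.sum_const, nsmul_eq_mul]
          refine mul_le_mul_of_nonneg_right ?_ (hT0 a p)
          have hsub : ((F a k).filter fun q => p = q ∨ p + 1 = q) ⊆ {p, p + 1} := by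
            intro q hq
            rcases (Finset.mem_filter.1 hq).2 with rfl | rfl <;> simp
          exact_mod_cast (Finset.card_le_card hsub).trans Finset.card_le_two
      _ = _ := (Finset.mul_sum _ _ _).symm
  have hTle : ∀ a p, T a p ≤ t * b * (6 ^ d * (k + 1) ^ (d - 2)) *
      (2 * ((k - sInf {f | p ∈ F a f} + 2).choose 2 : ℕ)) := by
    intro a p
    set x := k - sInf {f | p ∈ F a f} with hx
    have hxk : (x : ℝ) ≤ k := by exact_mod_cast Nat.sub_le _ _
    have hch : ((x : ℝ) + 1) ^ 2 ≤ 2 * ((x + 2).choose 2 : ℕ) := by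
      rw [Nat.cast_choose_two]
      push_cast
      nlinarith
    calc T a p = t * b * (6 ^ d * (x + 1) ^ (d - 2)) * (x + 1) ^ 2 := by
          simp only [hT]
          rw [← hx, mul_pow, ← Nat.sub_add_cancel hd, Nat.add_sub_cancel, pow_add ((x : ℝ) + 1)]
          ring
      _ ≤ _ := by gcongr
  have hsum : ∀ a, ∑ p ∈ F a k, T a p ≤ t * b * (6 ^ d * (k + 1) ^ (d - 2)) *
      (2 * (k + (e + m) + 2).choose (e + m + 2)) := by
    intro a
    refine (Finset.sum_le_sum fun p _ => hTle a p).trans ?_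
    rw [← Finset.mul_sum, ← Finset.mul_sum]
    have := sum_choose_sub_find_le (hFmono a) (hFcard a) 2 k
    have : (∑ p ∈ F a k, ((k - sInf {f | p ∈ F a f} + 2).choose 2 : ℕ) : ℝ) ≤
        (k + (e + m) + 2).choose (e + m + 2) := by exact_mod_cast this
    gcongr
  calc (W.card : ℝ) ≤ ∑ a ∈ Finset.range L, ∑ q ∈ F a k,
        ((W.filter (InOctave δ (dyadicScale D₀ L a) v q)).card : ℝ) := by exact_mod_cast h1
    _ ≤ ∑ a ∈ Finset.range L, 2 * (t * b * (6 ^ d * (k + 1) ^ (d - 2)) *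
      (2 * (k + (e + m) + 2).choose (e + m + 2))) := by
        refine Finset.sum_le_sum fun a _ => (hoct a).trans ?_
        exact mul_le_mul_of_nonneg_left (hsum a) zero_le_two
    _ = _ := by
        rw [Finset.sum_const, Finset.card_range, nsmul_eq_mul]
        ring

end Refined

lemma exists_ball_data (hd : 1 ≤ d) {S : Finset (Body d)} (hball : ∀ u ∈ S, IsBall u)
    {F : Finset (Body d)} (hF : F ⊆ S) {c : EuclideanSpace ℝ (Fin d)} {r : ℝ}
    (hFr : ∀ u ∈ F, ∃ y ∈ u, ‖y - c‖ ≤ r) :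
    ∃ z : Body d → EuclideanSpace ℝ (Fin d), (∀ u ∈ F, (u : Set (EuclideanSpace ℝ (Fin d))) =
        Metric.closedBall (z u) (Metric.diam (u : Set (EuclideanSpace ℝ (Fin d))) / 2)) ∧
      ∀ u ∈ F, ‖z u - c‖ ≤ Metric.diam (u : Set (EuclideanSpace ℝ (Fin d))) / 2 + r := by
  have : Nonempty (Fin d) := ⟨⟨0, hd⟩⟩
  have h : ∀ u ∈ F, ∃ z, (u : Set (EuclideanSpace ℝ (Fin d))) =
      Metric.closedBall z (Metric.diam (u : Set (EuclideanSpace ℝ (Fin d))) / 2) := by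
    intro u hu
    obtain ⟨z, R, hR, huR⟩ := hball u (hF hu)
    refine ⟨z, ?_⟩
    rw [huR, Metric.diam_closedBall_eq z hR.le, mul_div_cancel_left₀ R two_ne_zero]
  choose! z hz using h
  refine ⟨z, hz, fun u hu => ?_⟩
  obtain ⟨y, hy, hyc⟩ := hFr u hu
  have hy' := mem_closedBall_iff_norm'.1 ((Set.ext_iff.1 (hz u hu) y).1 hy)
  calc ‖z u - c‖ = ‖(z u - y) + (y - c)‖ := by rw [sub_add_sub_cancel]
    _ ≤ ‖z u - y‖ + ‖y - c‖ := norm_add_le _ _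
    _ ≤ _ := add_le_add hy' hyc

lemma card_balls_mul_pred_le (hd : 1 ≤ d) {t : ℕ} {S : Finset (Body d)} (hS : IsThin t S)
    (hball : ∀ u ∈ S, IsBall u) {F : Finset (Body d)} (hF : F ⊆ S)
    {c : EuclideanSpace ℝ (Fin d)} {r Δ : ℝ} (hr : 0 < r)
    (hFr : ∀ u ∈ F, ∃ y ∈ u, ‖y - c‖ ≤ r)
    (hFΔ : ∀ u ∈ F, Δ ≤ Metric.diam (u : Set (EuclideanSpace ℝ (Fin d)))) {M : ℕ} (hM : 1 ≤ M)
    (hΔ : 96 * d ^ 2 * M ^ 2 * r < Δ) : F.card * (M - 1) ≤ 2 * t * M := by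
  obtain ⟨z, hz, hzc⟩ := exists_ball_data hd hball hF hFr
  exact hS.card_mul_pred_le hd hF hz hr hzc hM fun u hu => by linarith [hFΔ u hu]

lemma card_balls_le_of_dim_one {t : ℕ} {S : Finset (Body 1)} (hS : IsThin t S)
    (hball : ∀ u ∈ S, IsBall u) {F : Finset (Body 1)} (hF : F ⊆ S)
    {c : EuclideanSpace ℝ (Fin 1)} {r Δ : ℝ} (hr : 0 < r)
    (hFr : ∀ u ∈ F, ∃ y ∈ u, ‖y - c‖ ≤ r)
    (hFΔ : ∀ u ∈ F, Δ ≤ Metric.diam (u : Set (EuclideanSpace ℝ (Fin 1))))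
    (hΔ : 24 * r < Δ) : F.card ≤ 2 * t := by
  obtain ⟨z, hz, hzc⟩ := exists_ball_data le_rfl hball hF hFr
  exact hS.card_le_of_dim_one hF hz hr hzc fun u hu => by linarith [hFΔ u hu]

/-- Raising the lower index of the bound by `y` costs a factor of at most `(1 + k / n) ^ y`. -/
lemma choose_add_le_mul_pow {k n : ℕ} (hn : 1 ≤ n) (y : ℕ) :
    ((k + (n + y)).choose (n + y) : ℝ) ≤ (k + n).choose n * (1 + k / n) ^ y := by
  have hn' : (1 : ℝ) ≤ n := by exact_mod_cast hn
  induction y with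
  | zero => simp
  | succ y ih =>
    have h := Nat.add_one_mul_choose_eq (k + (n + y)) (n + y)
    have h' : ((k : ℝ) + (n + y) + 1) * ((k + (n + y)).choose (n + y) : ℕ) =
        ((k + (n + (y + 1))).choose (n + (y + 1)) : ℕ) * ((n : ℝ) + y + 1) := by
      exact_mod_cast h
    have hpos : (0 : ℝ) < (n : ℝ) + y + 1 := by positivity
    have heq : ((k + (n + (y + 1))).choose (n + (y + 1)) : ℝ) =
        (k + (n + y)).choose (n + y) * (1 + k / (n + y + 1)) := by
      field_simp
      rw [← h']
      ring
    rw [heq, pow_succ, ← mul_assoc]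
    refine mul_le_mul ih ?_ (by positivity) (by positivity)
    have : (k : ℝ) / (n + y + 1) ≤ k / n := by
      refine div_le_div_of_nonneg_left (Nat.cast_nonneg k) (by linarith) ?_
      have : (0 : ℝ) ≤ y := Nat.cast_nonneg y
      linarith
    linarith

/-- The constant, depending only on the dimension, that is absorbed by `√k` for large `k`. -/
noncomputable def ballConstant (d : ℕ) : ℝ := 4 * 6 ^ d * ((21 * d) ^ 3 * Real.exp (20 * d))

/-- If `t` is not small compared to `√k`, then the few levels and objects by which the refined bound
exceeds the desired lower index `2 * t + 2` cost a factor of order `k ^ (3 / 2)`, which is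
less than the gain of order `k ^ 2`. -/
lemma refined_bound_le {d k t x : ℕ} (hd : 2 ≤ d) (ht : 1 ≤ t) (hk : ballConstant d ^ 2 ≤ k)
    (hk1 : 1 ≤ k) (hkt : k ≤ 96 * d ^ 2 * (2 * t + 2) ^ 2) (hx : x * k ≤ 40 * d * t) :
    (4 * 6 ^ d * (k + 1) ^ (d - 2) : ℝ) *
      (k + (3 + (2 * t + x)) + 2).choose (3 + (2 * t + x) + 2) ≤
      (4 * k - 1) ^ d * (k + (2 + 2 * t)).choose (2 + 2 * t) := by
  have hk1' : (1 : ℝ) ≤ k := by exact_mod_cast hk1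
  have ht' : (1 : ℝ) ≤ t := by exact_mod_cast ht
  have hd' : (2 : ℝ) ≤ d := by exact_mod_cast hd
  set s := √(k : ℝ) with hs
  have hs2 : s ^ 2 = k := Real.sq_sqrt (by linarith)
  have hs1 : 1 ≤ s := Real.one_le_sqrt.2 hk1'
  have hst : s ≤ 40 * d * t := by
    refine Real.sqrt_le_iff.2 ⟨by positivity, ?_⟩
    have h1 : (k : ℝ) ≤ 96 * d ^ 2 * (2 * t + 2) ^ 2 := by exact_mod_cast hkt
    have h2 : (2 * (t : ℝ) + 2) ^ 2 ≤ (4 * t) ^ 2 := by gcongr; linarith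
    calc (k : ℝ) ≤ 96 * d ^ 2 * (4 * t) ^ 2 := h1.trans (by gcongr)
      _ ≤ (40 * d * t) ^ 2 := by
        have : (0 : ℝ) ≤ (d * t) ^ 2 := by positivity
        nlinarith
  have hkt' : (k : ℝ) / (2 * t) ≤ 20 * d * s := by
    rw [div_le_iff₀ (by positivity)]
    nlinarith
  have hch := choose_add_le_mul_pow (k := k) (n := 2 + 2 * t) (by omega) (3 + x)
  rw [show k + (2 + 2 * t + (3 + x)) = k + (3 + (2 * t + x)) + 2 by ring,
    show 2 + 2 * t + (3 + x) = 3 + (2 * t + x) + 2 by ring] at hch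
  have hbase : 1 + (k : ℝ) / (2 + 2 * t : ℕ) ≤ 1 + k / (2 * t) := by
    have : (k : ℝ) / (2 + 2 * t : ℕ) ≤ k / (2 * t) := by
      refine div_le_div_of_nonneg_left (by linarith) (by positivity) ?_
      push_cast
      linarith
    linarith
  have hx' : (x : ℝ) * k ≤ 40 * d * t := by exact_mod_cast hx
  have hpow : (1 + (k : ℝ) / (2 + 2 * t : ℕ)) ^ (3 + x) ≤
      (21 * d) ^ 3 * Real.exp (20 * d) * s ^ 3 := by
    rw [pow_add]
    have h3 : (1 + (k : ℝ) / (2 + 2 * t : ℕ)) ^ 3 ≤ (21 * d * s) ^ 3 := by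
      gcongr
      have : 1 ≤ d * s := one_le_mul_of_one_le_of_one_le (by linarith) hs1
      linarith
    have hexp : (1 + (k : ℝ) / (2 + 2 * t : ℕ)) ^ x ≤ Real.exp (20 * d) := by
      calc (1 + (k : ℝ) / (2 + 2 * t : ℕ)) ^ x ≤ (1 + (k : ℝ) / (2 * t)) ^ x := by gcongr
        _ ≤ Real.exp (k / (2 * t)) ^ x := by
          gcongr
          rw [add_comm]
          exact Real.add_one_le_exp _
        _ = Real.exp (x * (k / (2 * t))) := (Real.exp_nat_mul _ _).symm
        _ ≤ Real.exp (20 * d) := by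
          refine Real.exp_le_exp.2 ?_
          rw [mul_div_assoc', div_le_iff₀ (by positivity)]
          linarith
    calc _ ≤ (21 * d * s) ^ 3 * Real.exp (20 * d) := by gcongr
      _ = _ := by ring
  have hC0 : 0 ≤ ballConstant d := by unfold ballConstant; positivity
  have hCs : ballConstant d ≤ s := Real.le_sqrt_of_sq_le hk
  have h4 : (k : ℝ) + 1 ≤ 4 * k - 1 := by linarith
  have h5 : (0 : ℝ) ≤ (4 * k - 1) ^ (d - 2) := pow_nonneg (by linarith) _
  set X : ℝ := (((k + (2 + 2 * t)).choose (2 + 2 * t) : ℕ) : ℝ) with hX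
  calc (4 * 6 ^ d * (k + 1) ^ (d - 2) : ℝ) *
        (k + (3 + (2 * t + x)) + 2).choose (3 + (2 * t + x) + 2)
      ≤ (4 * 6 ^ d * (k + 1) ^ (d - 2)) *
        (X * ((21 * d) ^ 3 * Real.exp (20 * d) * s ^ 3)) := by
        refine mul_le_mul_of_nonneg_left (hch.trans ?_) (by positivity)
        gcongr
    _ = (k + 1) ^ (d - 2) * (ballConstant d * s ^ 3) * X := by
        unfold ballConstant
        ring
    _ ≤ (4 * k - 1) ^ (d - 2) * (s * s ^ 3) * X := by gcongr
    _ = (4 * k - 1) ^ (d - 2) * (k : ℝ) ^ 2 * X := by rw [← hs2]; ring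
    _ ≤ (4 * k - 1) ^ (d - 2) * (4 * k - 1) ^ 2 * X := by
        have : (0 : ℝ) ≤ 4 * k - 1 := by linarith
        gcongr
        linarith
    _ = _ := by rw [← pow_add, Nat.sub_add_cancel hd]

lemma wcol_le_of_isBall (hd : 1 ≤ d) {t k : ℕ} (ht : 1 ≤ t) {S : Finset (Body d)}
    (hS : IsThin t S) {prec : S → S → Prop} (hprec : IsSizewise S prec)
    (hball : ∀ u ∈ S, IsBall u) (hk : ⌈ballConstant d ^ 2⌉₊ + 40 * d ≤ k) :
    wcol (intersectionGraph S) prec k ≤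
      t * max 1 ⌈Real.logb 2 (k : ℝ)⌉₊ * (4 * k - 1) ^ d *
        Nat.choose (k + 2 * t + 2) (2 * t + 2) := by
  have hk40 : 40 * d ≤ k := by omega
  have hk1 : 1 ≤ k := by omega
  have hk1' : (1 : ℝ) ≤ k := by exact_mod_cast hk1
  have hC : ballConstant d ^ 2 ≤ k := Nat.ceil_le.1 (by omega)
  have h := isSizing_of_isBall hd hball
  set L := max 1 ⌈Real.logb 2 (k : ℝ)⌉₊ with hL
  have hL1 : 1 ≤ L := le_max_left _ _
  have hkL : k ≤ 2 ^ L := le_two_pow_max_ceil_logb hk1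
  suffices hmain : (wcol (intersectionGraph S) prec k : ℝ) ≤
      t * L * ((4 * k - 1) ^ d * (k + (2 + 2 * t)).choose (2 + 2 * t)) by
    rw [← Nat.cast_le (α := ℝ)]
    push_cast [Nat.cast_sub (by omega : 1 ≤ 4 * k)]
    refine hmain.trans_eq ?_
    rw [show k + (2 + 2 * t) = k + 2 * t + 2 by ring, show 2 + 2 * t = 2 * t + 2 by ring]
    ring
  have h4 : (0 : ℝ) ≤ 4 * k - 1 := by linarith
  refine wcol_le_of_isReached h hprec k (by positivity) fun v hv W hW => ?_
  obtain ⟨c, hc, hcv⟩ := h.exists_center v hv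
  -- The distance from `c` within which objects matter, compared to the scale.
  have hdist : ∀ D, IsScale k D → ∀ i, 0 < ((k : ℝ) - 1 + 1 / 2) * D i ∧
      ((k : ℝ) - 1 + 1 / 2) * D i < k * D i := fun D hD i =>
    ⟨mul_pos (by linarith) (hD.pos i), mul_lt_mul_of_pos_right (by linarith) (hD.pos i)⟩
  have hD2 : ∀ D, IsScale k D → ∀ i, (k : ℝ) * (k * D i) ≤ D (i + 2) := fun D hD i =>
    (mul_le_mul_of_nonneg_left (hD.mul_le i) (by linarith)).trans (hD.mul_le (i + 1))
  -- In the first case, sizes two levels up exceed the distance by enough to have `M = 2 * t + 2`,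
  -- or the dimension is one; either way at most `2 * t` balls are counted.
  by_cases hcase : d = 1 ∨ 96 * d ^ 2 * (2 * t + 2) ^ 2 ≤ k
  · refine (hW.card_le ht hk1 hL1 hkL hS h hc hcv (e := 2) (m := 2 * t) ?_).trans_eq (by ring)
    intro D hD i F hF hFD hFc
    obtain ⟨hr, hrk⟩ := hdist D hD i
    have hDk := hD2 D hD i
    rcases hcase with rfl | hcase
    · refine card_balls_le_of_dim_one hS hball hF hr hFc hFD ?_
      have : (24 : ℝ) ≤ k := by exact_mod_cast (by omega : 24 ≤ k)
      nlinarith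
    · have key := card_balls_mul_pred_le hd hS hball hF hr hFc hFD (M := 2 * t + 2) (by omega) (by
        have : (96 * d ^ 2 * (2 * t + 2 : ℕ) ^ 2 : ℝ) ≤ k := by exact_mod_cast hcase
        nlinarith)
      rw [show 2 * t + 2 - 1 = 2 * t + 1 by omega] at key
      by_contra! hlt
      have : (2 * t + 1) * (2 * t + 1) ≤ F.card * (2 * t + 1) := Nat.mul_le_mul_right _ hlt
      nlinarith
  · push Not at hcase
    obtain ⟨hd1, hcase⟩ := hcase
    -- Three levels up, the ratio of size and distance is at least `k ^ 2`, which allows for `M` of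
    -- order `k`; the excess `x` over `2 * t` is then at most of order `t / k`.
    set M := k / (10 * d) with hM
    have hM1 : 10 * d * M ≤ k := Nat.mul_div_le k (10 * d)
    have hM2 : k < 10 * d * (M + 1) := by
      rw [mul_comm]
      exact Nat.lt_mul_of_div_lt (Nat.lt_succ_self _) (by omega)
    have hM4 : 4 ≤ M := (Nat.le_div_iff_mul_le (by omega)).2 (by omega)
    obtain ⟨M', hM'⟩ : ∃ M', M = M' + 1 := ⟨M - 1, by omega⟩
    have hM'pos : 0 < M' := by omega
    set x := 2 * t / M' with hx
    have hxM : x * M' ≤ 2 * t := Nat.div_mul_le_self _ _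
    have hkM' : k ≤ 20 * d * M' := by
      rw [hM'] at hM2
      nlinarith
    have key := hW.card_le_of_two_le (by omega) ht hk1 hL1 hkL hS h hc hcv (e := 3)
      (m := 2 * t + x) (by
        intro D hD i F hF hFD hFc
        obtain ⟨hr, hrk⟩ := hdist D hD i
        have hDk := hD2 D hD i
        have hDi := hD.pos i
        have hD3 : (k : ℝ) * (k * (k * D i)) ≤ D (i + 3) :=
          (mul_le_mul_of_nonneg_left hDk (by linarith)).trans (hD.mul_le (i + 2))
        have h1 := card_balls_mul_pred_le hd hS hball hF hr hFc hFD (M := M) (by omega) (by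
          have hdM : ((10 * d * M : ℕ) : ℝ) ≤ k := by exact_mod_cast hM1
          push_cast at hdM
          have hsq : (10 * d * M : ℝ) ^ 2 ≤ k ^ 2 := by gcongr
          have hsq' : (96 * d ^ 2 * M ^ 2 : ℝ) ≤ k ^ 2 := by nlinarith [sq_nonneg (d * M : ℝ)]
          calc (96 * d ^ 2 * M ^ 2 : ℝ) * ((k - 1 + 1 / 2) * D i)
              ≤ k ^ 2 * ((k - 1 + 1 / 2) * D i) := by gcongr
            _ < k ^ 2 * (k * D i) := by gcongr
            _ = k * (k * (k * D i)) := by ring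
            _ ≤ D (i + 3) := hD3)
        rw [hM', Nat.add_sub_cancel] at h1
        have h2 : F.card ≤ 2 * t * (M' + 1) / M' := (Nat.le_div_iff_mul_le hM'pos).2 h1
        rwa [mul_add, mul_one, mul_comm (2 * t) M', Nat.mul_add_div hM'pos] at h2)
    refine key.trans ?_
    have hfin := refined_bound_le (x := x) (by omega : 2 ≤ d) ht hC hk1 hcase.le (by
      calc x * k ≤ x * (20 * d * M') := Nat.mul_le_mul_left x hkM'
        _ = 20 * d * (x * M') := by ring
        _ ≤ 20 * d * (2 * t) := Nat.mul_le_mul_left _ hxM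
        _ = _ := by ring)
    rw [mul_one, mul_assoc]
    exact mul_le_mul_of_nonneg_left hfin (by positivity)

end ThinIntersection

theorem mainTheorem1 (d : ℕ) (hd : 1 ≤ d) :
    (∀ t : ℕ, 1 ≤ t → ∀ S : Finset (ThinIntersection.Body d), ThinIntersection.IsThin t S →
      ∀ prec : S → S → Prop, ThinIntersection.IsSizewise S prec → ∀ k : ℕ, 1 ≤ k →
        (ThinIntersection.IsHomothetFamily S →
          ThinIntersection.wcol (ThinIntersection.intersectionGraph S) prec k ≤
            t * max 1 ⌈Real.logb 2 (k : ℝ)⌉₊ * (4 * k - 1) ^ d *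
              Nat.choose (k + t * 5 ^ d + 2) (t * 5 ^ d + 2)) ∧
        (∀ b : ℝ, 1 ≤ b → (∀ u ∈ S, ThinIntersection.IsBallLike b u) →
          (ThinIntersection.wcol (ThinIntersection.intersectionGraph S) prec k : ℝ) ≤
            (t : ℝ) * b * (max 1 ⌈Real.logb 2 (k : ℝ)⌉₊ : ℕ) * (4 * (k : ℝ)) ^ d *
              (Nat.choose (k + ⌊(t : ℝ) * b * 6 ^ d⌋₊ + 2) (⌊(t : ℝ) * b * 6 ^ d⌋₊ + 2) : ℕ))) ∧
    (∃ k₀ : ℕ, 1 ≤ k₀ ∧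
      ∀ t : ℕ, 1 ≤ t → ∀ S : Finset (ThinIntersection.Body d), ThinIntersection.IsThin t S →
        ∀ prec : S → S → Prop, ThinIntersection.IsSizewise S prec →
          (∀ u ∈ S, ThinIntersection.IsBall u) → ∀ k : ℕ, k₀ ≤ k →
            ThinIntersection.wcol (ThinIntersection.intersectionGraph S) prec k ≤
              t * max 1 ⌈Real.logb 2 (k : ℝ)⌉₊ * (4 * k - 1) ^ d *
                Nat.choose (k + 2 * t + 2) (2 * t + 2)) :=
  ⟨fun _ ht _ hS _ hprec _ hk =>
    ⟨ThinIntersection.wcol_le_of_isHomothetFamily hd ht hS hprec hk,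
      fun _ hb hball => ThinIntersection.wcol_le_of_isBallLike hd ht hS hprec hk hb hball⟩,
    ⌈ThinIntersection.ballConstant d ^ 2⌉₊ + 40 * d, by omega,
    fun _ ht _ hS _ hprec hball _ hk =>
      ThinIntersection.wcol_le_of_isBall hd ht hS hprec hball hk⟩
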